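/- **Theorem 4.1 (fully discrete stability).** Let $\beta(t)=\dfrac{e^{-\sigma t}t^{\alpha-1}\cos(\gamma t)}{\Gamma(\alpha)}$, where either (i) $\alpha=1$, $\sigma>1$, $0\le\gamma\le\sigma$, or (ii) $\alpha=\tfrac12$, $\sigma>1$, $0\le\gamma\le\sqrt3\,\sigma$. Put $K(t)=\int_t^\infty\beta(s)\,ds$ and $\mu_0=1-K(0)$. There is a constant $C>0$, depending only on $\alpha,\sigma,\gamma$ (in particular independent of $T$, $m$, $\tau$ and of the discrete space), such that the following holds. Let $\Omega\subset\mathbb R^d$ be bounded and open, let $\mathcal S_h$ be a finite-dimensional subspace of $H^1_0(\Omega)$, and let $(\cdot,\cdot)$, $\|\cdot\|$ be the inner product and norm of $L^2(\Omega)$. Let $\mu_1,\mu_2\ge0$ with $\mu_1^2+\mu_2^2>0$, and let $G$ satisfy (A1) $G(z)\ge g_0$ for all $z\ge0$, for some constant $g_0>0$; (A2) $G$ is continuously differentiable on $[0,\infty)$ with $0\le G'(z)\le\mathcal L$ for all $z\ge 0$, for some constant $\mathcal L$. Let $0<T<\infty$, $\tau>0$, $t_n=n\tau$, let $f$ be a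 function of time with values in $L^2(\Omega)$, $f^n=f(t_n)$, and let $u_{0h},u_{1h},u_{2h}\in\mathcal S_h$. For $U^n\in\mathcal S_h$ write, for $n\ge1$, $$\delta_tU^n=\tfrac{U^n-U^{n-1}}{\tau},\quad \delta_t^2U^n=\delta_t(\delta_tU^{n+1}),\quad \bar\delta_tU^n=\tfrac{U^{n+1}-U^{n-1}}{2\tau},\quad \widetilde U^n=\tfrac{U^{n+1}+U^{n-1}}2,\qquad \bar\delta_tU^0:=u_{1h},$$ and, for $0\le p\le n$, $$\widetilde\kappa_{np}=\int_{-\min(\tau,t_p)}^{\min(\tau,t_{n-p})}K(t_{n-p}-s)\max\Bigl(1-\Bigl|\frac s\tau\Bigr|,0\Bigr)ds .$$ The fully discrete scheme on $[0,T]$ is: $U^0=u_{0h}$, $U^1=u_{0h}+\tau u_{1h}+\frac{\tau^2}2u_{2h}$ and, for all integers $1\le n\le T/\tau$ and all $\psi_h\in\mathcal S_h$, $$(\delta_t^2U^n,\psi_h)+G\bigl(\mu_1\|U^n\|^2+\mu_2\|\nabla U^n\|^2\bigr)(\bar\delta_tU^n,\psi_h)+\mu_0(\nabla\widetilde U^n,\nabla\psi_h)+\sum_{p=0}^n\widetilde\kappa_{np}(\nabla\bar\delta_tU^p,\nabla\psi_h)=(f^n,\psi_h)+\varepsilon\,K(t_n)(\nabla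 U^0,\nabla\psi_h),$$ where $\varepsilon\in\{1,-1\}$ is a fixed sign (the theorem holds for either choice). Define the semi-norm $$\|U^m\|_A=\sqrt{\|\delta_tU^{m+1}\|^2+\tfrac{\mu_0}2\bigl(\|\nabla U^{m+1}\|^2+\|\nabla U^m\|^2\bigr)} .$$ Then every solution of the scheme satisfies, for every integer $m$ with $1\le m\le T/\tau$, $$\|U^m\|_A\le\|U^0\|_A+C\Bigl(\|\nabla u_{0h}\|+\|\nabla u_{1h}\|+\tau\sum_{i=0}^m\|f^i\|\Bigr).$$ Moreover, the scheme has a solution, and it is unique: $U^n$ is uniquely determined for $0\le n\le\lfloor T/\tau\rfloor+1$. -/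

import Mathlib

open MeasureTheory

noncomputable section

namespace HyperbolicMemory

/-! ### The kernel -/

/-- The variable-sign kernel `β(t) = e^{-σ t} t^{α-1} cos(γ t) / Γ(α)`. -/
def beta (α σ γ t : ℝ) : ℝ :=
  Real.exp (-σ * t) * t ^ (α - 1) * Real.cos (γ * t) / Real.Gamma α

/-- The two admissible parameter ranges of the kernel. -/
def Admissible (α σ γ : ℝ) : Prop :=
  (α = 1 ∧ 1 < σ ∧ 0 ≤ γ ∧ γ ≤ σ) ∨
    (α = 1 / 2 ∧ 1 < σ ∧ 0 ≤ γ ∧ γ ≤ Real.sqrt 3 * σ)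

/-- The transformed kernel `K(t) = ∫_t^∞ β(s) ds`. -/
def kernelK (α σ γ t : ℝ) : ℝ := ∫ s in Set.Ioi t, beta α σ γ s

/-- `μ₀ = 1 - K(0)`. -/
def mu0 (α σ γ : ℝ) : ℝ := 1 - kernelK α σ γ 0

/-- The weight `κ̃_{np}` (`0 ≤ p ≤ n`, `n ≥ 1`) of the interpolating quadrature
`∫_0^{t_n} K(t_n - s) φ(s) ds ≈ ∑_{p=0}^n κ̃_{np} φ(t_p)`, `t_j = j τ`, in which `φ` is replaced by
its piecewise linear interpolant: the integral over `[0, t_n]` of `K(t_n - ·)` against the hat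
function of height one centred at `t_p`, written with `s` measured from `t_p`. -/
def kappa (α σ γ τ : ℝ) (n p : ℕ) : ℝ :=
  ∫ s in (-(min τ (p * τ)))..(min τ ((n - p : ℕ) * τ)),
    kernelK α σ γ ((n - p : ℕ) * τ - s) * max (1 - |s / τ|) 0

/-! ### The nonlinear coefficient -/

/-- `G(z) ≥ g₀ > 0` for `z ≥ 0`. -/
def AssumptionA1 (G : ℝ → ℝ) : Prop := ∃ g₀ : ℝ, 0 < g₀ ∧ ∀ z, 0 ≤ z → g₀ ≤ G z

/-- `G` is continuously differentiable on `[0, ∞)` with `0 ≤ G' ≤ L`. -/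
def AssumptionA2 (G : ℝ → ℝ) : Prop :=
  ContDiffOn ℝ 1 G (Set.Ici 0) ∧
    ∃ L : ℝ, ∀ z, 0 ≤ z →
      0 ≤ derivWithin G (Set.Ici 0) z ∧ derivWithin G (Set.Ici 0) z ≤ L

/-! ### Function spaces -/

section Sobolev

variable {d : ℕ}

/-- `L²(Ω)`. -/
abbrev L2 (Ω : Set (EuclideanSpace ℝ (Fin d))) : Type :=
  Lp ℝ 2 (volume.restrict Ω)

/-- `L²(Ω; ℝ^d)`. -/
abbrev L2vec (Ω : Set (EuclideanSpace ℝ (Fin d))) : Type :=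
  Lp (EuclideanSpace ℝ (Fin d)) 2 (volume.restrict Ω)

/-- `φ ∈ C_c^∞(Ω)`. -/
def IsTest (Ω : Set (EuclideanSpace ℝ (Fin d))) (φ : EuclideanSpace ℝ (Fin d) → ℝ) : Prop :=
  ContDiff ℝ (⊤ : ℕ∞) φ ∧ HasCompactSupport φ ∧ tsupport φ ⊆ Ω

/-- `g` is the weak gradient of `u` on `Ω`. -/
def IsWeakGradient (Ω : Set (EuclideanSpace ℝ (Fin d))) (u : L2 Ω) (g : L2vec Ω) : Prop :=
  ∀ φ : EuclideanSpace ℝ (Fin d) → ℝ, IsTest Ω φ →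
    ∫ x in Ω, u x • gradient φ x = -∫ x in Ω, φ x • g x

theorem IsTest.continuous_gradient {Ω : Set (EuclideanSpace ℝ (Fin d))}
    {φ : EuclideanSpace ℝ (Fin d) → ℝ} (h : IsTest Ω φ) : Continuous (gradient φ) :=
  (InnerProductSpace.toDual ℝ (EuclideanSpace ℝ (Fin d))).symm.continuous.comp
    (h.1.continuous_fderiv (by simp))

theorem IsTest.hasCompactSupport_gradient {Ω : Set (EuclideanSpace ℝ (Fin d))}
    {φ : EuclideanSpace ℝ (Fin d) → ℝ} (h : IsTest Ω φ) : HasCompactSupport (gradient φ) :=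
  (h.2.1.fderiv (𝕜 := ℝ)).comp_left (map_zero _)

theorem IsTest.integrable_smul_gradient {Ω : Set (EuclideanSpace ℝ (Fin d))}
    {φ : EuclideanSpace ℝ (Fin d) → ℝ} (h : IsTest Ω φ) (u : L2 Ω) :
    Integrable (fun x => u x • gradient φ x) (volume.restrict Ω) :=
  memLp_one_iff_integrable.1 <|
    (h.continuous_gradient.memLp_of_hasCompactSupport (p := 2)
      h.hasCompactSupport_gradient).smul (Lp.memLp u)

theorem IsTest.integrable_smul {Ω : Set (EuclideanSpace ℝ (Fin d))}
    {φ : EuclideanSpace ℝ (Fin d) → ℝ} (h : IsTest Ω φ) (g : L2vec Ω) :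
    Integrable (fun x => φ x • g x) (volume.restrict Ω) :=
  memLp_one_iff_integrable.1 <|
    (Lp.memLp g).smul (h.1.continuous.memLp_of_hasCompactSupport (p := 2) h.2.1)

/-- `H¹(Ω)`, as the space of pairs `(u, ∇u)` in `L²(Ω) × L²(Ω; ℝ^d)`, where `∇u` is the weak
gradient of `u`; the norm of the product is equivalent to the usual norm of `H¹(Ω)`. -/
def H1 (Ω : Set (EuclideanSpace ℝ (Fin d))) : Submodule ℝ (L2 Ω × L2vec Ω) where
  carrier := {p | IsWeakGradient Ω p.1 p.2}
  zero_mem' := by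
    intro φ _
    have h1 : (fun x => (0 : L2 Ω) x • gradient φ x) =ᵐ[volume.restrict Ω] fun _ => 0 := by
      filter_upwards [Lp.coeFn_zero ℝ 2 (volume.restrict Ω)] with x hx
      rw [hx, Pi.zero_apply, zero_smul]
    have h2 : (fun x => φ x • (0 : L2vec Ω) x) =ᵐ[volume.restrict Ω] fun _ => 0 := by
      filter_upwards [Lp.coeFn_zero (EuclideanSpace ℝ (Fin d)) 2 (volume.restrict Ω)] with x hx
      rw [hx, Pi.zero_apply, smul_zero]
    simp only [Prod.fst_zero, Prod.snd_zero]
    rw [integral_congr_ae h1, integral_congr_ae h2]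
    simp
  add_mem' := by
    intro p q hp hq φ hφ
    have h1 : (fun x => (p.1 + q.1 : L2 Ω) x • gradient φ x) =ᵐ[volume.restrict Ω]
        fun x => p.1 x • gradient φ x + q.1 x • gradient φ x := by
      filter_upwards [Lp.coeFn_add p.1 q.1] with x hx
      rw [hx, Pi.add_apply, add_smul]
    have h2 : (fun x => φ x • (p.2 + q.2 : L2vec Ω) x) =ᵐ[volume.restrict Ω]
        fun x => φ x • p.2 x + φ x • q.2 x := by
      filter_upwards [Lp.coeFn_add p.2 q.2] with x hx
      rw [hx, Pi.add_apply, smul_add]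
    simp only [Prod.fst_add, Prod.snd_add]
    rw [integral_congr_ae h1, integral_congr_ae h2,
      integral_add (hφ.integrable_smul_gradient _) (hφ.integrable_smul_gradient _),
      integral_add (hφ.integrable_smul _) (hφ.integrable_smul _), hp φ hφ, hq φ hφ, neg_add]
  smul_mem' := by
    intro c p hp φ hφ
    have h1 : (fun x => (c • p.1 : L2 Ω) x • gradient φ x) =ᵐ[volume.restrict Ω]
        fun x => c • (p.1 x • gradient φ x) := by
      filter_upwards [Lp.coeFn_smul c p.1] with x hx
      rw [hx, Pi.smul_apply, smul_assoc]
    have h2 : (fun x => φ x • (c • p.2 : L2vec Ω) x) =ᵐ[volume.restrict Ω]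
        fun x => c • (φ x • p.2 x) := by
      filter_upwards [Lp.coeFn_smul c p.2] with x hx
      rw [hx, Pi.smul_apply, smul_comm]
    simp only [Prod.smul_fst, Prod.smul_snd]
    rw [integral_congr_ae h1, integral_congr_ae h2, integral_smul, integral_smul, hp φ hφ,
      smul_neg]

/-- The pairs `(φ, ∇φ)` with `φ ∈ C_c^∞(Ω)`. -/
def testPairs (Ω : Set (EuclideanSpace ℝ (Fin d))) : Set (L2 Ω × L2vec Ω) :=
  {p | ∃ φ : EuclideanSpace ℝ (Fin d) → ℝ, IsTest Ω φ ∧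
    p.1 =ᵐ[volume.restrict Ω] φ ∧ p.2 =ᵐ[volume.restrict Ω] gradient φ}

/-- `H¹₀(Ω)`: the closure of `C_c^∞(Ω)` in `H¹(Ω)`. -/
def H10 (Ω : Set (EuclideanSpace ℝ (Fin d))) : Submodule ℝ (L2 Ω × L2vec Ω) :=
  H1 Ω ⊓ (Submodule.span ℝ (testPairs Ω)).topologicalClosure

variable {Ω : Set (EuclideanSpace ℝ (Fin d))} {Sh : Submodule ℝ (H10 Ω)}

/-- An element of a subspace of `H¹₀(Ω)`, as a function in `L²(Ω)`. -/
def fn (v : Sh) : L2 Ω := (v : H10 Ω).1.1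

/-- The gradient of an element of a subspace of `H¹₀(Ω)`. -/
def grad (v : Sh) : L2vec Ω := (v : H10 Ω).1.2

/-! ### The fully discrete scheme -/

/-- `δ_t U^n = (U^n - U^{n-1}) / τ`, `n ≥ 1`. -/
def deltaT (τ : ℝ) (U : ℕ → Sh) (n : ℕ) : Sh := τ⁻¹ • (U n - U (n - 1))

/-- `δ_t² U^n = δ_t (δ_t U^{n+1}) = (δ_t U^{n+1} - δ_t U^n) / τ`, `n ≥ 1`. -/
def deltaT2 (τ : ℝ) (U : ℕ → Sh) (n : ℕ) : Sh := τ⁻¹ • (deltaT τ U (n + 1) - deltaT τ U n)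

/-- `δ̄_t U^n = (U^{n+1} - U^{n-1}) / (2τ)` for `n ≥ 1`, with the convention
`δ̄_t U^0 = u_{1h}`. -/
def deltaBar (τ : ℝ) (u1h : Sh) (U : ℕ → Sh) (n : ℕ) : Sh :=
  if n = 0 then u1h else (2 * τ)⁻¹ • (U (n + 1) - U (n - 1))

/-- `Ũ^n = (U^{n+1} + U^{n-1}) / 2`, `n ≥ 1`. -/
def avg (U : ℕ → Sh) (n : ℕ) : Sh := (2 : ℝ)⁻¹ • (U (n + 1) + U (n - 1))

/-- The equation of the scheme at level `n ≥ 1`, tested with all of `S_h`. The number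
`ε ∈ {1, -1}` is the sign of the term `K(t_n) (∇U^0, ∇ψ_h)`. -/
def SchemeAt (α σ γ : ℝ) (G : ℝ → ℝ) (μ₁ μ₂ ε τ : ℝ) (f : ℝ → L2 Ω) (u1h : Sh)
    (U : ℕ → Sh) (n : ℕ) : Prop :=
  ∀ ψ : Sh,
    inner ℝ (fn (deltaT2 τ U n)) (fn ψ)
      + G (μ₁ * ‖fn (U n)‖ ^ 2 + μ₂ * ‖grad (U n)‖ ^ 2)
          * inner ℝ (fn (deltaBar τ u1h U n)) (fn ψ)
      + mu0 α σ γ * inner ℝ (grad (avg U n)) (grad ψ)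
      + ∑ p ∈ Finset.range (n + 1),
          kappa α σ γ τ n p * inner ℝ (grad (deltaBar τ u1h U p)) (grad ψ)
    = inner ℝ (f (n * τ)) (fn ψ)
      + ε * (kernelK α σ γ (n * τ) * inner ℝ (grad (U 0)) (grad ψ))

/-- `U^0, U^1, …` solve the fully discrete scheme on `[0, T]`: the initial values are the prescribed
ones and the equation holds at all levels `1 ≤ n ≤ T/τ`. Only the `U^n` with `n ≤ ⌊T/τ⌋ + 1` are
constrained. -/
def IsSolution (α σ γ : ℝ) (G : ℝ → ℝ) (μ₁ μ₂ ε T τ : ℝ) (f : ℝ → L2 Ω) (u0h u1h u2h : Sh)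
    (U : ℕ → Sh) : Prop :=
  U 0 = u0h ∧ U 1 = u0h + τ • u1h + (τ ^ 2 / 2) • u2h ∧
    ∀ n : ℕ, 1 ≤ n → (n : ℝ) ≤ T / τ → SchemeAt α σ γ G μ₁ μ₂ ε τ f u1h U n

/-- The semi-norm
`‖U^m‖_A = (‖δ_t U^{m+1}‖² + (μ₀ / 2) (‖∇U^{m+1}‖² + ‖∇U^m‖²))^{1/2}`. -/
def normA (α σ γ τ : ℝ) (U : ℕ → Sh) (m : ℕ) : ℝ :=
  Real.sqrt (‖fn (deltaT τ U (m + 1))‖ ^ 2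
    + mu0 α σ γ / 2 * (‖grad (U (m + 1))‖ ^ 2 + ‖grad (U m)‖ ^ 2))

end Sobolev

end HyperbolicMemory

end

noncomputable section

namespace HyperbolicMemory

open scoped FourierTransform
open Set Filter Topology

/-! ### The hat function as a nonnegative superposition of cosines -/

/-! Stability is an energy estimate. Testing level `n` with the centred quotient `δ̄U^n` makes the
second difference and the `μ₀` term telescope to the change of `‖U‖_A²` over one step, up to the
factor `2τ`, and (A1) gives the damping a sign. What remains is the memory term.

The memory weights with `1 ≤ p < n` are samples at `t_n - t_p` of the convolution of the even kernel
`K(|·|)` with a hat function. For `p = n` only half of the hat lies in `[0, t_n]`, so twice the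
triangular form over `p ≥ 1` is a full symmetric Toeplitz form. It is positive semidefinite because
both factors have nonnegative cosine transforms. For the hat this is the Fejér kernel. For `K`,
integration by parts reduces the claim to the sine transform of `β`, which is a half-sum of `Im (σ -
ix)^(-α)` at `x = ω ± γ`; only this step uses the upper bounds on `γ` (`div_add_div_nonneg_of_le`,
`im_cpow_half_add_nonneg`). The result is `Admissible.sum_sum_kappa_mul_inner_nonneg`.

The weights with `p = 0` are absolutely summable uniformly in `τ`, and `K(t_n)` has bounded
variation, so summation by parts handles the `∇U^0` term. In both, the factor `2τ` cancels the
denominator of `∇δ̄U^n`, leaving gradients that the energy controls, with no inverse inequality. At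
a level of maximal energy `N` this gives `N² ≤ N₀² + N X` with `N₀ ≤ N`, hence `N ≤ N₀ + X`.

Since `G` is evaluated at the known `U^n`, each step is a linear problem with a positive definite
form; this yields existence and uniqueness. -/

theorem continuous_hat (τ : ℝ) : Continuous fun s : ℝ => max (1 - |s / τ|) 0 := by fun_prop

theorem hat_le_one (τ s : ℝ) : max (1 - |s / τ|) 0 ≤ 1 :=
  max_le (by linarith [abs_nonneg (s / τ)]) zero_le_one

theorem hat_eq_zero {τ s : ℝ} (hτ : 0 < τ) (hs : τ ≤ |s|) : max (1 - |s / τ|) 0 = 0 := by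
  apply max_eq_right
  rw [abs_div, abs_of_pos hτ, sub_nonpos, one_le_div hτ]
  exact hs

theorem integrable_hat {τ : ℝ} (hτ : 0 < τ) :
    Integrable fun s : ℝ => max (1 - |s / τ|) 0 := by
  refine (continuous_hat τ).integrable_of_hasCompactSupport ?_
  refine HasCompactSupport.intro (isCompact_Icc (a := -τ) (b := τ)) fun x hx => ?_
  refine hat_eq_zero hτ ?_
  by_contra! h
  exact hx (abs_le.1 h.le)

theorem integral_eq_zero_of_odd {g : ℝ → ℝ} (hg : ∀ x, g (-x) = -g x) : ∫ x, g x = 0 := by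
  have h := integral_neg_eq_self g volume
  simp_rw [hg, integral_neg] at h
  linarith

/-- Evenness reduces this to an explicit antiderivative on `[0, 1]`. The value is a Fejér kernel;
its visible nonnegativity is what matters. -/
theorem integral_hat_mul_cos {a : ℝ} (ha : a ≠ 0) :
    ∫ v : ℝ, max (1 - |v|) 0 * Real.cos (a * v) = 2 * (1 - Real.cos a) / a ^ 2 := by
  have h1 : (fun v : ℝ => max (1 - |v|) 0 * Real.cos (a * v))
      = fun v => (fun x : ℝ => max (1 - x) 0 * Real.cos (a * x)) |v| := by
    funext v
    rcases abs_cases v with ⟨h, -⟩ | ⟨h, -⟩ <;> simp [h]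
  rw [h1, integral_comp_abs (f := fun x : ℝ => max (1 - x) 0 * Real.cos (a * x))]
  have h2 : ∫ x in Ioi (0 : ℝ), max (1 - x) 0 * Real.cos (a * x)
      = ∫ x in Ioc (0 : ℝ) 1, max (1 - x) 0 * Real.cos (a * x) := by
    refine setIntegral_eq_of_subset_of_forall_sdiff_eq_zero measurableSet_Ioi
      Ioc_subset_Ioi_self fun x hx => ?_
    have : 1 < x := by
      by_contra! h
      exact hx.2 ⟨hx.1, h⟩
    rw [max_eq_right (by linarith), zero_mul]
  rw [h2, ← intervalIntegral.integral_of_le zero_le_one]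
  have h3 : ∫ x in (0 : ℝ)..1, max (1 - x) 0 * Real.cos (a * x)
      = ∫ x in (0 : ℝ)..1, (1 - x) * Real.cos (a * x) := by
    refine intervalIntegral.integral_congr fun x hx => ?_
    rw [uIcc_of_le zero_le_one] at hx
    rw [max_eq_left (by linarith [hx.2])]
  rw [h3, intervalIntegral.integral_eq_sub_of_hasDerivAt
    (f := fun x => (1 - x) * Real.sin (a * x) / a - Real.cos (a * x) / a ^ 2)]
  · simp
    field_simp
    ring
  · intro x _
    have hs : HasDerivAt (fun x => Real.sin (a * x)) (Real.cos (a * x) * a) x := by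
      simpa using ((hasDerivAt_id x).const_mul a).sin
    have hc : HasDerivAt (fun x => Real.cos (a * x)) (-Real.sin (a * x) * a) x := by
      simpa using ((hasDerivAt_id x).const_mul a).cos
    convert! ((((hasDerivAt_id x).const_sub 1).mul hs).div_const a).sub (hc.div_const (a ^ 2))
      using 1
    simp
    field_simp
    ring
  · exact (by fun_prop : Continuous fun x : ℝ => (1 - x) * Real.cos (a * x)).intervalIntegrable _ _

theorem fourier_hat {ξ : ℝ} (hξ : ξ ≠ 0) :
    𝓕 (fun v : ℝ => ((max (1 - |v|) 0 : ℝ) : ℂ)) ξ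
      = ((2 * (1 - Real.cos (2 * Real.pi * ξ)) / (2 * Real.pi * ξ) ^ 2 : ℝ) : ℂ) := by
  rw [Real.fourier_real_eq_integral_exp_smul]
  have hhat : Integrable fun v : ℝ => max (1 - |v|) 0 := by
    simpa using integrable_hat one_pos
  have hC : Integrable fun v : ℝ => max (1 - |v|) 0 * Real.cos (2 * Real.pi * ξ * v) :=
    hhat.mul_bdd (c := 1) (by fun_prop)
      (Eventually.of_forall fun x => by simpa using Real.abs_cos_le_one _)
  have hS : Integrable fun v : ℝ => max (1 - |v|) 0 * Real.sin (2 * Real.pi * ξ * v) :=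
    hhat.mul_bdd (c := 1) (by fun_prop)
      (Eventually.of_forall fun x => by simpa using Real.abs_sin_le_one _)
  have h1 : ∀ v : ℝ, Complex.exp (↑(-2 * Real.pi * v * ξ) * Complex.I)
      • ((max (1 - |v|) 0 : ℝ) : ℂ)
      = ((max (1 - |v|) 0 * Real.cos (2 * Real.pi * ξ * v) : ℝ) : ℂ)
        - ((max (1 - |v|) 0 * Real.sin (2 * Real.pi * ξ * v) : ℝ) : ℂ) * Complex.I := by
    intro v
    rw [Complex.exp_mul_I, ← Complex.ofReal_cos, ← Complex.ofReal_sin,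
      show -2 * Real.pi * v * ξ = -(2 * Real.pi * ξ * v) by ring, Real.cos_neg, Real.sin_neg,
      smul_eq_mul]
    push_cast
    ring
  simp_rw [h1]
  rw [integral_sub hC.ofReal (hS.ofReal.mul_const _), integral_mul_const,
    integral_complex_ofReal, integral_complex_ofReal,
    integral_hat_mul_cos (by simp [hξ, Real.pi_ne_zero]),
    integral_eq_zero_of_odd (fun x => by simp)]
  simp

/-- The hat function is the cosine transform of a nonnegative integrable function. -/
theorem exists_hat_eq_integral_cos (τ : ℝ) :
    ∃ S : ℝ → ℝ, Integrable S ∧ (∀ᵐ ω, 0 ≤ S ω) ∧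
      ∀ s, max (1 - |s / τ|) 0 = ∫ ω, S ω * Real.cos (2 * Real.pi / τ * ω * s) := by
  set f : ℝ → ℂ := fun v => ((max (1 - |v|) 0 : ℝ) : ℂ) with hf
  have hfc : Continuous f := by fun_prop
  have hfi : Integrable f := by
    have : Integrable fun v : ℝ => max (1 - |v|) 0 := by simpa using integrable_hat one_pos
    exact this.ofReal
  have hne : ∀ᵐ ξ : ℝ, ξ ≠ 0 := by simp [ae_iff]
  have hnn : ∀ ξ : ℝ, 0 ≤ 2 * (1 - Real.cos (2 * Real.pi * ξ)) / (2 * Real.pi * ξ) ^ 2 :=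
    fun ξ => div_nonneg (by linarith [Real.cos_le_one (2 * Real.pi * ξ)]) (sq_nonneg _)
  have hFc : Continuous (𝓕 f) :=
    VectorFourier.fourierIntegral_continuous Real.continuous_fourierChar
      (innerSL ℝ).continuous₂ hfi
  -- The `L¹` bound near the origin and the decay `ξ⁻²` at infinity add up to a multiple of `1 / (1
  -- + ξ²)`.
  have hFi : Integrable (𝓕 f) := by
    refine Integrable.mono' (integrable_inv_one_add_sq.const_mul ((∫ v, ‖f v‖) + 1))
      hFc.aestronglyMeasurable ?_
    filter_upwards [hne] with ξ hξ
    have b1 : ‖𝓕 f ξ‖ ≤ ∫ v, ‖f v‖ :=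
      VectorFourier.norm_fourierIntegral_le_integral_norm _ _ _ _ _
    have b2 : ξ ^ 2 * ‖𝓕 f ξ‖ ≤ 1 := by
      rw [fourier_hat hξ, Complex.norm_real, Real.norm_of_nonneg (hnn ξ)]
      have hpi : (1 : ℝ) ≤ Real.pi ^ 2 := by nlinarith [Real.pi_gt_three]
      have e : ξ ^ 2 * (2 * (1 - Real.cos (2 * Real.pi * ξ)) / (2 * Real.pi * ξ) ^ 2)
          = (1 - Real.cos (2 * Real.pi * ξ)) / (2 * Real.pi ^ 2) := by
        field_simp
      rw [e, div_le_one (by positivity)]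
      linarith [Real.neg_one_le_cos (2 * Real.pi * ξ)]
    rw [← div_eq_mul_inv, le_div_iff₀ (by positivity)]
    linarith
  refine ⟨fun ξ => (𝓕 f ξ).re, hFi.re, ?_, fun s => ?_⟩
  · filter_upwards [hne] with ξ hξ
    rw [fourier_hat hξ, Complex.ofReal_re]
    exact hnn ξ
  · have inv := congrFun (hfc.fourierInv_fourier_eq hfi hFi) (s / τ)
    rw [Real.fourierInv_eq'] at inv
    have hint : Integrable fun v : ℝ =>
        Complex.exp (↑(2 * Real.pi * inner ℝ v (s / τ)) * Complex.I) • 𝓕 f v := by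
      refine hFi.bdd_mul (c := 1) (by fun_prop) (Eventually.of_forall fun v => ?_)
      rw [Complex.norm_exp_ofReal_mul_I]
    have re := congrArg Complex.re inv
    rw [hf, Complex.ofReal_re] at re
    rw [← re, ← RCLike.re_eq_complex_re, ← integral_re hint]
    refine integral_congr_ae ?_
    filter_upwards [hne] with ξ hξ
    rw [hf, fourier_hat hξ, smul_eq_mul, RCLike.re_eq_complex_re, Complex.re_mul_ofReal,
      Complex.exp_ofReal_mul_I_re, Complex.ofReal_re, mul_comm]
    congr 2
    simp
    ring

/-! ### Quadratic forms of sampled convolutions with the hat function -/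

/-- Convolution becomes multiplication of cosine transforms: Fubini, the substitution `u = y - s`
and the addition formula, whose sine part vanishes because `F` is even. -/
theorem integral_mul_hat_sub {F S : ℝ → ℝ} {τ : ℝ} (hF : Integrable F)
    (hev : ∀ x, F (-x) = F x) (hS : Integrable S)
    (hhat : ∀ s, max (1 - |s / τ|) 0 = ∫ ω, S ω * Real.cos (2 * Real.pi / τ * ω * s)) (y : ℝ) :
    ∫ s, F (y - s) * max (1 - |s / τ|) 0
      = ∫ ω, S ω * (∫ u, F u * Real.cos (2 * Real.pi / τ * ω * u))
          * Real.cos (2 * Real.pi / τ * ω * y) := by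
  conv_lhs => simp only [hhat, ← integral_const_mul]
  have hFy : Integrable fun s => F (y - s) := hF.comp_sub_left y
  rw [integral_integral_swap]
  · refine integral_congr_ae (Eventually.of_forall fun ω => ?_)
    simp only
    set c := 2 * Real.pi / τ * ω
    rw [← integral_sub_left_eq_self (fun s => F (y - s) * (S ω * Real.cos (c * s))) volume y]
    have hC : Integrable fun u : ℝ => F u * Real.cos (c * u) :=
      hF.mul_bdd (c := 1) (by fun_prop)
        (Eventually.of_forall fun x => by simpa using Real.abs_cos_le_one _)
    have hSn : Integrable fun u : ℝ => F u * Real.sin (c * u) :=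
      hF.mul_bdd (c := 1) (by fun_prop)
        (Eventually.of_forall fun x => by simpa using Real.abs_sin_le_one _)
    have e : ∀ u, F (y - (y - u)) * (S ω * Real.cos (c * (y - u)))
        = S ω * Real.cos (c * y) * (F u * Real.cos (c * u))
          + S ω * Real.sin (c * y) * (F u * Real.sin (c * u)) := by
      intro u
      rw [mul_sub, Real.cos_sub, sub_sub_cancel]
      ring
    simp_rw [e]
    rw [integral_add (hC.const_mul _) (hSn.const_mul _), integral_const_mul, integral_const_mul,
      integral_eq_zero_of_odd (g := fun u => F u * Real.sin (c * u)) (fun x => by simp [hev])]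
    ring
  · have := (hFy.mul_prod hS).mul_bdd (c := 1)
      (g := fun p : ℝ × ℝ => Real.cos (2 * Real.pi / τ * p.2 * p.1))
      (by fun_prop) (Eventually.of_forall fun x => by simpa using Real.abs_cos_le_one _)
    refine this.congr (Eventually.of_forall fun p => ?_)
    simp only [Function.uncurry]
    ring

/-- This is `‖∑ exp(i θ_n) φ_n‖²`, split into its cosine and sine parts. -/
theorem sum_sum_cos_sub_mul_inner_nonneg {H : Type*} [NormedAddCommGroup H]
    [InnerProductSpace ℝ H] (s : Finset ℕ) (θ : ℕ → ℝ) (φ : ℕ → H) :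
    0 ≤ ∑ n ∈ s, ∑ p ∈ s, Real.cos (θ n - θ p) * inner ℝ (φ p) (φ n) := by
  have e : ∑ n ∈ s, ∑ p ∈ s, Real.cos (θ n - θ p) * inner ℝ (φ p) (φ n)
      = ‖∑ n ∈ s, Real.cos (θ n) • φ n‖ ^ 2 + ‖∑ n ∈ s, Real.sin (θ n) • φ n‖ ^ 2 := by
    simp_rw [← real_inner_self_eq_norm_sq, sum_inner, inner_sum, ← Finset.sum_add_distrib]
    refine Finset.sum_congr rfl fun n _ => Finset.sum_congr rfl fun p _ => ?_
    simp_rw [real_inner_smul_left, real_inner_smul_right, Real.cos_sub,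
      real_inner_comm (φ p) (φ n)]
    ring
  rw [e]
  positivity

/-- If the even function `F` has a nonnegative cosine transform, then sampling the convolution of
`F` with a hat function gives a positive semidefinite Toeplitz form. -/
theorem sum_sum_integral_hat_mul_inner_nonneg {H : Type*} [NormedAddCommGroup H]
    [InnerProductSpace ℝ H] {F : ℝ → ℝ} {τ : ℝ} (hτ : 0 < τ) (hF : Integrable F)
    (hev : ∀ x, F (-x) = F x) (hpos : ∀ ω, 0 < ω → 0 ≤ ∫ u, F u * Real.cos (ω * u))
    (s : Finset ℕ) (φ : ℕ → H) :
    0 ≤ ∑ n ∈ s, ∑ p ∈ s,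
      (∫ x, F ((n : ℝ) * τ - p * τ - x) * max (1 - |x / τ|) 0) * inner ℝ (φ p) (φ n) := by
  obtain ⟨S, hS, hS0, hhat⟩ := exists_hat_eq_integral_cos τ
  simp_rw [integral_mul_hat_sub hF hev hS hhat, ← integral_mul_const]
  have hρ : ∀ y c : ℝ, Integrable fun ω =>
      S ω * (∫ u, F u * Real.cos (2 * Real.pi / τ * ω * u))
        * Real.cos (2 * Real.pi / τ * ω * y) * c := by
    intro y c
    refine Integrable.mul_const ?_ c
    refine Integrable.mul_bdd (c := 1) ?_ (by fun_prop)
      (Eventually.of_forall fun x => by simpa using Real.abs_cos_le_one _)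
    refine Integrable.mul_bdd (c := ∫ u, ‖F u‖) hS ?_ (Eventually.of_forall fun ω => ?_)
    · have hc : Continuous fun ω : ℝ => ∫ u, F u * Real.cos (2 * Real.pi / τ * ω * u) := by
        refine continuous_of_dominated (bound := fun u => ‖F u‖)
          (fun ω => hF.aestronglyMeasurable.mul (by fun_prop)) (fun ω => Eventually.of_forall
            fun u => ?_) hF.norm (Eventually.of_forall fun u => by fun_prop)
        rw [norm_mul]
        exact mul_le_of_le_one_right (norm_nonneg _) (by simpa using Real.abs_cos_le_one _)
      exact hc.aestronglyMeasurable
    · refine (norm_integral_le_integral_norm _).trans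
        (integral_mono_of_nonneg (Eventually.of_forall fun u => norm_nonneg _) hF.norm
          (Eventually.of_forall fun u => ?_))
      simp only
      rw [norm_mul]
      exact mul_le_of_le_one_right (norm_nonneg _) (by simpa using Real.abs_cos_le_one _)
  have hswap : ∑ n ∈ s, ∑ p ∈ s, ∫ ω, S ω * (∫ u, F u * Real.cos (2 * Real.pi / τ * ω * u))
        * Real.cos (2 * Real.pi / τ * ω * ((n : ℝ) * τ - p * τ)) * inner ℝ (φ p) (φ n)
      = ∫ ω, ∑ n ∈ s, ∑ p ∈ s, S ω * (∫ u, F u * Real.cos (2 * Real.pi / τ * ω * u))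
        * Real.cos (2 * Real.pi / τ * ω * ((n : ℝ) * τ - p * τ)) * inner ℝ (φ p) (φ n) := by
    rw [integral_finsetSum _ fun n _ => integrable_finsetSum _ fun p _ => hρ _ _]
    refine Finset.sum_congr rfl fun n _ => ?_
    rw [integral_finsetSum _ fun p _ => hρ _ _]
  rw [hswap]
  refine integral_nonneg_of_ae ?_
  have hne : ∀ᵐ ω : ℝ, ω ≠ 0 := by simp [ae_iff]
  filter_upwards [hS0, hne] with ω hω hω0
  -- Positivity is assumed at positive frequencies only. Negative ones follow from the evenness of
  -- cosine, and zero is a null set.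
  have hcos : 0 ≤ ∫ u, F u * Real.cos (2 * Real.pi / τ * ω * u) := by
    have hpos' : 0 < |2 * Real.pi / τ * ω| := by
      rw [abs_pos]
      have := Real.pi_ne_zero
      have := hτ.ne'
      positivity
    refine (hpos _ hpos').trans_eq (integral_congr_ae (Eventually.of_forall fun u => ?_))
    simp only
    rcases abs_cases (2 * Real.pi / τ * ω) with ⟨h, -⟩ | ⟨h, -⟩ <;> simp [h]
  have := mul_nonneg (mul_nonneg hω hcos)
    (sum_sum_cos_sub_mul_inner_nonneg s (fun n => 2 * Real.pi / τ * ω * (n * τ)) φ)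
  refine this.trans_eq ?_
  rw [Finset.mul_sum]
  refine Finset.sum_congr rfl fun n _ => ?_
  rw [Finset.mul_sum]
  refine Finset.sum_congr rfl fun p _ => ?_
  rw [mul_sub]
  ring

/-! ### Tail integrals -/

section Tail

variable {b : ℝ → ℝ}

/-- The indicator makes the integrand integrable on the whole line, so that the continuity and
differentiability of primitives apply although nothing is known of `b` on `(-∞, 0]`. -/
theorem tail_eq_sub (hb : IntegrableOn b (Ioi 0)) {t : ℝ} (ht : 0 ≤ t) :
    ∫ s in Ioi t, b s = (∫ s in Ioi 0, b s) - ∫ s in (0 : ℝ)..t, (Ioi 0).indicator b s := by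
  have h : ∫ s in (0 : ℝ)..t, (Ioi 0).indicator b s = ∫ s in (0 : ℝ)..t, b s := by
    rw [intervalIntegral.integral_of_le ht, intervalIntegral.integral_of_le ht]
    exact setIntegral_congr_fun measurableSet_Ioc fun s hs => indicator_of_mem hs.1 _
  rw [h, ← intervalIntegral.integral_Ioi_sub_Ioi hb ht, sub_sub_cancel]

theorem continuous_tail_abs (hb : IntegrableOn b (Ioi 0)) :
    Continuous fun t : ℝ => ∫ s in Ioi |t|, b s := by
  simp_rw [fun t : ℝ => tail_eq_sub hb (abs_nonneg t)]
  have hi : Integrable ((Ioi 0).indicator b) := (integrable_indicator_iff measurableSet_Ioi).2 hb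
  exact continuous_const.sub ((intervalIntegral.continuous_primitive
    (fun _ _ => hi.intervalIntegrable) 0).comp continuous_abs)

theorem hasDerivAt_tail (hb : IntegrableOn b (Ioi 0)) (hc : ContinuousOn b (Ioi 0)) {t : ℝ}
    (ht : 0 < t) : HasDerivAt (fun t : ℝ => ∫ s in Ioi t, b s) (-b t) t := by
  have hi : Integrable ((Ioi 0).indicator b) := (integrable_indicator_iff measurableSet_Ioi).2 hb
  have hev : (Ioi 0).indicator b =ᶠ[𝓝 t] b := by
    filter_upwards [Ioi_mem_nhds ht] with s hs using indicator_of_mem hs _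
  have hct : ContinuousAt ((Ioi 0).indicator b) t :=
    (hc.continuousAt (Ioi_mem_nhds ht)).congr hev.symm
  have hd := intervalIntegral.integral_hasDerivAt_right (a := 0) (b := t)
    hi.intervalIntegrable (hi.aestronglyMeasurable.stronglyMeasurableAtFilter) hct
  rw [indicator_of_mem (mem_Ioi.2 ht)] at hd
  refine (hd.const_sub (∫ s in Ioi 0, b s)).congr_of_eventuallyEq ?_
  filter_upwards [Ioi_mem_nhds ht] with s hs using tail_eq_sub hb (le_of_lt hs)

/-- The tail of `|b|` is decreasing, so the right side telescopes along a grid and bounds the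
variation of the tail of `b`. -/
theorem abs_tail_sub_tail_le (hb : IntegrableOn b (Ioi 0)) {t s : ℝ} (ht : 0 ≤ t) (hts : t ≤ s) :
    |(∫ x in Ioi t, b x) - ∫ x in Ioi s, b x|
      ≤ (∫ x in Ioi t, |b x|) - ∫ x in Ioi s, |b x| := by
  have hbt : IntegrableOn b (Ioi t) := hb.mono_set (Ioi_subset_Ioi ht)
  rw [intervalIntegral.integral_Ioi_sub_Ioi hbt hts,
    intervalIntegral.integral_Ioi_sub_Ioi hbt.abs hts]
  exact intervalIntegral.abs_integral_le_integral_abs hts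

theorem abs_tail_le (hb : IntegrableOn b (Ioi 0)) {t : ℝ} (ht : 0 ≤ t) :
    |∫ x in Ioi t, b x| ≤ ∫ x in Ioi 0, |b x| :=
  abs_integral_le_integral_abs.trans
    (setIntegral_mono_set hb.abs (Eventually.of_forall fun x => abs_nonneg (b x))
      (Ioi_subset_Ioi ht).eventuallyLE)

theorem tendsto_tail_atTop (hb : IntegrableOn b (Ioi 0)) :
    Tendsto (fun t : ℝ => ∫ s in Ioi t, b s) atTop (𝓝 0) := by
  have h := (intervalIntegral_tendsto_integral_Ioi 0 hb tendsto_id).const_sub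
    (∫ s in Ioi 0, b s)
  rw [sub_self] at h
  refine h.congr' ?_
  filter_upwards [eventually_ge_atTop 0] with t ht
  rw [id, ← intervalIntegral.integral_Ioi_sub_Ioi hb ht, sub_sub_cancel]

/-- The cosine transform of a tail integral, by integration by parts. -/
theorem integral_tail_mul_cos (hb : IntegrableOn b (Ioi 0)) (hc : ContinuousOn b (Ioi 0))
    (hK : IntegrableOn (fun t : ℝ => ∫ s in Ioi t, b s) (Ioi 0)) {ω : ℝ} (hω : ω ≠ 0) :
    ∫ t in Ioi (0 : ℝ), (∫ s in Ioi t, b s) * Real.cos (ω * t)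
      = (∫ s in Ioi (0 : ℝ), b s * Real.sin (ω * s)) / ω := by
  have hcos : ∀ t, HasDerivAt (fun t => Real.sin (ω * t) / ω) (Real.cos (ω * t)) t := by
    intro t
    have := (((hasDerivAt_id t).const_mul ω).sin).div_const ω
    simpa [hω] using this
  have hbdd : ∀ t, ‖Real.sin (ω * t) / ω‖ ≤ 1 / |ω| := fun t => by
    rw [norm_div, Real.norm_eq_abs, Real.norm_eq_abs]
    gcongr
    exact Real.abs_sin_le_one _
  have htend0 : Tendsto (fun t : ℝ => (∫ s in Ioi t, b s) * (Real.sin (ω * t) / ω))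
      (𝓝[>] 0) (𝓝 0) := by
    have h : Tendsto (fun t : ℝ => (∫ s in Ioi |t|, b s) * (Real.sin (ω * t) / ω)) (𝓝 0)
        (𝓝 0) := by
      have := ((continuous_tail_abs hb).mul
        (by fun_prop : Continuous fun t : ℝ => Real.sin (ω * t) / ω)).tendsto 0
      simpa [Pi.mul_def] using this
    refine (h.mono_left nhdsWithin_le_nhds).congr' ?_
    filter_upwards [self_mem_nhdsWithin] with t ht
    rw [abs_of_pos ht]
  have htend : Tendsto (fun t : ℝ => (∫ s in Ioi t, b s) * (Real.sin (ω * t) / ω))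
      atTop (𝓝 0) :=
    (tendsto_tail_atTop hb).zero_mul_isBoundedUnder_le
      (isBoundedUnder_of ⟨1 / |ω|, fun t => hbdd t⟩)
  have h := integral_Ioi_mul_deriv_eq_deriv_mul (a := 0)
    (fun t ht => hasDerivAt_tail hb hc ht) (fun t _ => hcos t)
    (hK.mul_bdd (c := 1) (by fun_prop)
      (Eventually.of_forall fun x => by simpa using Real.abs_cos_le_one _))
    (hb.neg.mul_bdd (c := 1 / |ω|) (by fun_prop) (Eventually.of_forall hbdd))
    htend0 htend
  rw [h, sub_self, zero_sub, ← integral_neg, ← integral_div]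
  refine integral_congr_ae (Eventually.of_forall fun s => ?_)
  simp only
  ring

end Tail

/-! ### Laplace transforms of `s ^ (α - 1)` -/

theorem integral_exp_mul_sin_one {σ : ℝ} (hσ : 0 < σ) (x : ℝ) :
    ∫ s in Ioi (0 : ℝ), Real.exp (-σ * s) * s ^ ((1 : ℝ) - 1) * Real.sin (x * s)
        / Real.Gamma 1 = (1 / ((σ : ℂ) - x * Complex.I)).im := by
  have hre : (-((σ : ℂ) - x * Complex.I)).re < 0 := by simpa using hσ
  have h := integral_exp_mul_complex_Ioi hre 0
  have hi := integrableOn_exp_mul_complex_Ioi hre 0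
  have him := congrArg Complex.im h
  rw [← RCLike.im_eq_complex_im, ← integral_im hi] at him
  rw [show (1 / ((σ : ℂ) - x * Complex.I)).im
      = RCLike.im (-Complex.exp (-((σ : ℂ) - x * Complex.I) * ((0 : ℝ) : ℂ))
        / -((σ : ℂ) - x * Complex.I)) by
      rw [neg_div_neg_eq, Complex.ofReal_zero, mul_zero, Complex.exp_zero]; rfl, ← him]
  refine setIntegral_congr_fun measurableSet_Ioi fun s hs => ?_
  simp [Complex.exp_im]

/-- With `s = t²` the Jacobian cancels `s^(-1/2)`, and the integral is the imaginary part of a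
Gaussian integral with complex parameter `σ - ix`. -/
theorem integral_exp_mul_sin_half {σ : ℝ} (hσ : 0 < σ) (x : ℝ) :
    ∫ s in Ioi (0 : ℝ), Real.exp (-σ * s) * s ^ ((1 / 2 : ℝ) - 1) * Real.sin (x * s)
        / Real.Gamma (1 / 2) = ((1 / ((σ : ℂ) - x * Complex.I)) ^ (1 / 2 : ℂ)).im := by
  set z : ℂ := (σ : ℂ) - x * Complex.I with hz
  have hre : 0 < z.re := by simpa [hz] using hσ
  have h := integral_gaussian_complex_Ioi hre
  have hi : IntegrableOn (fun t : ℝ => Complex.exp (-z * t ^ 2)) (Ioi 0) :=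
    (integrable_cexp_neg_mul_sq hre).integrableOn
  have him := congrArg Complex.im h
  rw [← RCLike.im_eq_complex_im, ← integral_im hi] at him
  have hsub := integral_comp_rpow_Ioi_of_pos (p := 2)
    (g := fun s => Real.exp (-σ * s) * s ^ ((1 / 2 : ℝ) - 1) * Real.sin (x * s)
        / Real.Gamma (1 / 2)) two_pos
  rw [← hsub]
  have hpi : 0 < √Real.pi := Real.sqrt_pos.2 Real.pi_pos
  have e : ∀ t ∈ Ioi (0 : ℝ), ((2 : ℝ) * t ^ ((2 : ℝ) - 1)) •
      (Real.exp (-σ * t ^ (2 : ℝ)) * (t ^ (2 : ℝ)) ^ ((1 / 2 : ℝ) - 1)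
        * Real.sin (x * t ^ (2 : ℝ)) / Real.Gamma (1 / 2))
      = 2 / √Real.pi * RCLike.im (Complex.exp (-z * t ^ 2)) := by
    intro t ht
    have ht0 : (0 : ℝ) < t := ht
    rw [Real.Gamma_one_half_eq, ← Real.rpow_mul ht0.le]
    have e1 : t ^ ((2 : ℝ) - 1) = t := by norm_num
    have e2 : t ^ ((2 : ℝ) * (1 / 2 - 1)) = t⁻¹ := by
      rw [show (2 : ℝ) * (1 / 2 - 1) = -1 by norm_num, Real.rpow_neg_one]
    have e3 : (-z * (t : ℂ) ^ 2).re = -σ * t ^ 2 := by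
      rw [← Complex.ofReal_pow, Complex.re_mul_ofReal]; simp [hz]
    have e4 : (-z * (t : ℂ) ^ 2).im = x * t ^ 2 := by
      rw [← Complex.ofReal_pow, Complex.im_mul_ofReal]; simp [hz]
    rw [e1, e2, RCLike.im_eq_complex_im, Complex.exp_im, e3, e4, smul_eq_mul, Real.rpow_two]
    field_simp
  rw [setIntegral_congr_fun measurableSet_Ioi e, integral_const_mul, him]
  -- The principal power splits here because one factor is a positive real.
  have hs : ((Real.pi : ℂ) / z) ^ (1 / 2 : ℂ) = (√Real.pi : ℝ) * (1 / z) ^ (1 / 2 : ℂ) := by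
    have hz0 : (1 : ℂ) / z ≠ 0 := one_div_ne_zero fun h0 => by simp [h0] at hre
    have hpi0 : (Real.pi : ℂ) ≠ 0 := Complex.ofReal_ne_zero.2 Real.pi_ne_zero
    rw [div_eq_mul_one_div, Complex.cpow_def_of_ne_zero (mul_ne_zero hpi0 hz0),
      Complex.log_ofReal_mul Real.pi_pos hz0, add_mul, Complex.exp_add,
      ← Complex.cpow_def_of_ne_zero hz0, Real.sqrt_eq_rpow, Complex.ofReal_cpow Real.pi_pos.le,
      Complex.cpow_def_of_ne_zero hpi0, Complex.ofReal_log Real.pi_pos.le]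
    simp
  rw [RCLike.im_eq_complex_im, hs, mul_div_assoc, Complex.im_ofReal_mul]
  have : ((1 / z) ^ (1 / 2 : ℂ) / 2).im = ((1 / z) ^ (1 / 2 : ℂ)).im / 2 := by
    simp
  rw [this]
  field_simp

/-! ### Positivity of the sine transform of the kernel -/

theorem im_one_div_sub_mul_I (σ x : ℝ) :
    (1 / ((σ : ℂ) - x * Complex.I)).im = x / (σ ^ 2 + x ^ 2) := by
  simp [Complex.normSq_apply, ← sq]

theorem re_one_div_sub_mul_I (σ x : ℝ) :
    (1 / ((σ : ℂ) - x * Complex.I)).re = σ / (σ ^ 2 + x ^ 2) := by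
  simp [Complex.normSq_apply, ← sq]

theorem div_add_div_nonneg_of_le {σ γ ω : ℝ} (hσ : 0 < σ) (hγ : 0 ≤ γ) (hγσ : γ ≤ σ)
    (hω : 0 < ω) :
    0 ≤ (ω + γ) / (σ ^ 2 + (ω + γ) ^ 2) + (ω - γ) / (σ ^ 2 + (ω - γ) ^ 2) := by
  have h1 : 0 < σ ^ 2 + (ω + γ) ^ 2 := by positivity
  have h2 : 0 < σ ^ 2 + (ω - γ) ^ 2 := by positivity
  rw [div_add_div _ _ h1.ne' h2.ne']
  refine div_nonneg ?_ (by positivity)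
  have : (ω + γ) * (σ ^ 2 + (ω - γ) ^ 2) + (σ ^ 2 + (ω + γ) ^ 2) * (ω - γ)
      = 2 * ω * (ω ^ 2 + (σ - γ) * (σ + γ)) := by ring
  rw [this]
  have := mul_nonneg (sub_nonneg.2 hγσ) (add_nonneg hσ.le hγ)
  positivity

/-- `σ / √(σ² + x²)`, as a function of `x ≥ 0`, lies above its tangent at `x = √3 σ`. -/
theorem tangent_le_div_sqrt {σ x : ℝ} (hσ : 0 < σ) (hx : 0 ≤ x) :
    7 / 8 - √3 * x / (8 * σ) ≤ σ * (1 / √(σ ^ 2 + x ^ 2)) := by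
  set z := √3 * (x / σ) with hz
  have h3 : √3 ^ 2 = (3 : ℝ) := Real.sq_sqrt (by norm_num)
  have hz0 : 0 ≤ z := by positivity
  have hzx : √3 * x / (8 * σ) = z / 8 := by rw [hz]; field_simp
  have hpos : 0 < √(σ ^ 2 + x ^ 2) := Real.sqrt_pos.2 (by positivity)
  have hsq : √(σ ^ 2 + x ^ 2) ^ 2 = σ ^ 2 * (1 + z ^ 2 / 3) := by
    rw [Real.sq_sqrt (by positivity), hz, mul_pow, h3]; field_simp
  rw [hzx, mul_one_div, le_div_iff₀ hpos]
  -- In the variable `z` the tangent is `(7 - z) / 8`, touching at `z = 3`. It is nonpositive for `z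
  -- ≥ 7`; below that, both sides can be squared, and tangency shows as the factor `(z - 3)²`.
  rcases le_total 7 z with h7 | h7
  · exact (mul_nonpos_of_nonpos_of_nonneg (by linarith) hpos.le).trans hσ.le
  · refine le_of_sq_le_sq ?_ hσ.le
    rw [mul_pow, hsq]
    have key : (7 / 8 - z / 8) ^ 2 * (1 + z ^ 2 / 3)
        = 1 - (z - 3) ^ 2 * (z * (7 - z) + z + 5) / 192 := by ring
    have : 0 ≤ (z - 3) ^ 2 * (z * (7 - z) + z + 5) := by
      have := mul_nonneg hz0 (sub_nonneg.2 h7)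
      positivity
    nlinarith [sq_nonneg σ]

/-- Put `r = |w|²` for the root `w = (σ - ix)^(-1/2)`; then `2 (Im w)² = r - σ r²`, and `Im w ≥ 0`
for `x ≥ 0`. Only `ω < γ` is delicate. There it suffices to compare the squares of the two imaginary
parts, that is, to show `(r₂ - r₁)(σ(r₁ + r₂) - 1) ≥ 0`. The tangent bound at `γ ± ω`, whose sum is
`2γ`, gives `σ(r₁ + r₂) ≥ 7/4 - √3 γ / (4σ) ≥ 1`. -/
theorem im_cpow_half_add_nonneg {σ γ ω : ℝ} (hσ : 0 < σ) (hγ : 0 ≤ γ) (hγσ : γ ≤ √3 * σ)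
    (hω : 0 < ω) :
    0 ≤ ((1 / ((σ : ℂ) - (ω + γ : ℝ) * Complex.I)) ^ (1 / 2 : ℂ)).im
      + ((1 / ((σ : ℂ) - (ω - γ : ℝ) * Complex.I)) ^ (1 / 2 : ℂ)).im := by
  have main : ∀ x : ℝ, ∃ r : ℝ, 0 < r ∧ r = 1 / √(σ ^ 2 + x ^ 2) ∧
      2 * ((1 / ((σ : ℂ) - x * Complex.I)) ^ (1 / 2 : ℂ)).im ^ 2 = r - σ * r ^ 2 ∧
      (0 ≤ x → 0 ≤ ((1 / ((σ : ℂ) - x * Complex.I)) ^ (1 / 2 : ℂ)).im) := by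
    intro x
    set v : ℂ := 1 / ((σ : ℂ) - x * Complex.I) with hv
    set w : ℂ := v ^ (1 / 2 : ℂ) with hw
    have hN : 0 < σ ^ 2 + x ^ 2 := by positivity
    have hvre : v.re = σ / (σ ^ 2 + x ^ 2) := re_one_div_sub_mul_I σ x
    have hvim : v.im = x / (σ ^ 2 + x ^ 2) := im_one_div_sub_mul_I σ x
    have hv0 : v ≠ 0 := fun h => by
      rw [h, Complex.zero_re] at hvre
      exact (div_pos hσ hN).ne hvre
    have hw2 : w ^ 2 = v := by
      rw [hw, ← Complex.cpow_nat_mul]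
      simp
    have hwre : 0 ≤ w.re := by
      -- The principal root halves the argument, which puts it in the closed right half-plane.
      rw [hw, Complex.cpow_def_of_ne_zero hv0, Complex.exp_re]
      refine mul_nonneg (Real.exp_pos _).le (Real.cos_nonneg_of_mem_Icc ?_)
      have e : (Complex.log v * (1 / 2)).im = v.arg / 2 := by
        simp [Complex.mul_im, Complex.log_im]; ring
      rw [e]
      constructor <;> linarith [Complex.neg_pi_lt_arg v, Complex.arg_le_pi v]
    have h1 : w.re ^ 2 - w.im ^ 2 = σ / (σ ^ 2 + x ^ 2) := by
      rw [← hvre, ← hw2, sq w, Complex.mul_re]; ring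
    have h2 : 2 * w.re * w.im = x / (σ ^ 2 + x ^ 2) := by
      rw [← hvim, ← hw2, sq w, Complex.mul_im]; ring
    have hr : w.re ^ 2 + w.im ^ 2 = 1 / √(σ ^ 2 + x ^ 2) := by
      refine (sq_eq_sq₀ (by positivity) (by positivity)).1 ?_
      rw [div_pow, Real.sq_sqrt hN.le]
      have : (w.re ^ 2 + w.im ^ 2) ^ 2
          = (w.re ^ 2 - w.im ^ 2) ^ 2 + (2 * w.re * w.im) ^ 2 := by ring
      rw [this, h1, h2]
      field_simp
    have hr2 : (1 / √(σ ^ 2 + x ^ 2)) ^ 2 = 1 / (σ ^ 2 + x ^ 2) := by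
      rw [div_pow, Real.sq_sqrt hN.le, one_pow]
    refine ⟨1 / √(σ ^ 2 + x ^ 2), by positivity, rfl, ?_, fun hx => ?_⟩
    · rw [hr2, mul_one_div]
      linarith
    · have hre : 0 < w.re := by
        refine lt_of_le_of_ne hwre fun h0 => ?_
        have := div_pos hσ hN
        rw [← h0] at h1
        nlinarith [sq_nonneg w.im]
      have := div_nonneg hx hN.le
      rw [← h2] at this
      exact nonneg_of_mul_nonneg_right this (by positivity)
  obtain ⟨r₁, hr₁, e₁, q₁, s₁⟩ := main (ω + γ)
  obtain ⟨r₂, hr₂, e₂, q₂, s₂⟩ := main (ω - γ)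
  set b₁ := ((1 / ((σ : ℂ) - (ω + γ : ℝ) * Complex.I)) ^ (1 / 2 : ℂ)).im
  set b₂ := ((1 / ((σ : ℂ) - (ω - γ : ℝ) * Complex.I)) ^ (1 / 2 : ℂ)).im
  have hb₁ : 0 ≤ b₁ := s₁ (by linarith)
  rcases le_total γ ω with h | h
  · exact add_nonneg hb₁ (s₂ (by linarith))
  · have t₁ := tangent_le_div_sqrt hσ (by linarith : 0 ≤ ω + γ)
    have t₂ := tangent_le_div_sqrt hσ (by linarith : 0 ≤ γ - ω)
    rw [show (γ - ω) ^ 2 = (ω - γ) ^ 2 by ring, ← e₂] at t₂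
    rw [← e₁] at t₁
    have hsum : 1 ≤ σ * (r₁ + r₂) := by
      have h3 : √3 * √3 = (3 : ℝ) := Real.mul_self_sqrt (by norm_num)
      have e : √3 * (ω + γ) / (8 * σ) + √3 * (γ - ω) / (8 * σ) = √3 * γ / (4 * σ) := by
        field_simp; ring
      have : √3 * γ / (4 * σ) ≤ 3 / 4 := by
        rw [div_le_iff₀ (by positivity)]
        nlinarith [mul_le_mul_of_nonneg_left hγσ (Real.sqrt_nonneg 3)]
      linarith
    have hle : r₁ ≤ r₂ := by
      rw [e₁, e₂]
      have : 0 < σ ^ 2 + (ω - γ) ^ 2 := by positivity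
      gcongr 1 / √(σ ^ 2 + ?_)
      nlinarith
    have : b₂ ^ 2 ≤ b₁ ^ 2 := by
      nlinarith [mul_nonneg (sub_nonneg.2 hle) (sub_nonneg.2 hsum)]
    linarith [neg_abs_le b₂, abs_le_of_sq_le_sq this hb₁]

/-! ### Properties of the memory kernel -/

section Kernel

variable {α σ γ : ℝ}

theorem Admissible.alpha_pos (h : Admissible α σ γ) : 0 < α := by
  rcases h with h | h <;> rw [h.1] <;> norm_num

theorem Admissible.one_lt_sigma (h : Admissible α σ γ) : 1 < σ := by
  rcases h with h | h <;> exact h.2.1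

theorem integral_exp_mul_rpow_div_Gamma (hα : 0 < α) (hσ : 0 < σ) :
    ∫ s in Ioi (0 : ℝ), Real.exp (-σ * s) * s ^ (α - 1) / Real.Gamma α = (1 / σ) ^ α := by
  have h := Real.integral_rpow_mul_exp_neg_mul_Ioi hα hσ
  simp_rw [integral_div, mul_comm (Real.exp _), neg_mul]
  rw [h, mul_div_cancel_right₀ _ (Real.Gamma_pos_of_pos hα).ne']

theorem integrableOn_exp_mul_rpow_div_Gamma (hα : 0 < α) (hσ : 0 < σ) :
    IntegrableOn (fun s => Real.exp (-σ * s) * s ^ (α - 1) / Real.Gamma α) (Ioi 0) :=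
  -- A nonintegrable function has integral `0` by convention, so a nonzero value proves
  -- integrability.
  Integrable.of_integral_ne_zero (by rw [integral_exp_mul_rpow_div_Gamma hα hσ]; positivity)

theorem abs_beta_le (hα : 0 < α) {s : ℝ} (hs : 0 < s) :
    |beta α σ γ s| ≤ Real.exp (-σ * s) * s ^ (α - 1) / Real.Gamma α := by
  have hΓ := Real.Gamma_pos_of_pos hα
  have hp : 0 < s ^ (α - 1) := Real.rpow_pos_of_pos hs _
  rw [beta, abs_div, abs_mul, abs_of_pos hΓ, abs_of_pos (mul_pos (Real.exp_pos _) hp)]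
  exact div_le_div_of_nonneg_right
    (mul_le_of_le_one_right (by positivity) (Real.abs_cos_le_one _)) hΓ.le

theorem continuousOn_beta : ContinuousOn (beta α σ γ) (Ioi 0) := by
  unfold beta
  refine ContinuousOn.div_const (ContinuousOn.mul (ContinuousOn.mul (by fun_prop) ?_)
    (by fun_prop)) _
  exact continuousOn_id.rpow_const fun s hs => Or.inl (ne_of_gt hs)

theorem integrableOn_beta (hα : 0 < α) (hσ : 0 < σ) : IntegrableOn (beta α σ γ) (Ioi 0) := by
  refine (integrableOn_exp_mul_rpow_div_Gamma hα hσ).mono'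
    (continuousOn_beta.aestronglyMeasurable measurableSet_Ioi) ?_
  filter_upwards [ae_restrict_mem measurableSet_Ioi] with s hs using abs_beta_le hα hs

theorem Admissible.integrableOn_beta (h : Admissible α σ γ) :
    IntegrableOn (beta α σ γ) (Ioi 0) :=
  HyperbolicMemory.integrableOn_beta h.alpha_pos (by linarith [h.one_lt_sigma])

/-- Dropping the cosine bounds `K(0)` by `σ^(-α)`, which is less than `1` because `σ > 1`. -/
theorem Admissible.mu0_pos (h : Admissible α σ γ) : 0 < mu0 α σ γ := by
  have hα := h.alpha_pos
  have hσ : 0 < σ := by linarith [h.one_lt_sigma]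
  have h1 : kernelK α σ γ 0 ≤ (1 / σ) ^ α := by
    rw [← integral_exp_mul_rpow_div_Gamma hα hσ, kernelK]
    exact setIntegral_mono_on h.integrableOn_beta (integrableOn_exp_mul_rpow_div_Gamma hα hσ)
      measurableSet_Ioi fun s hs => (le_abs_self _).trans (abs_beta_le hα hs)
  have h2 : (1 / σ) ^ α < 1 :=
    Real.rpow_lt_one (by positivity) ((div_lt_one hσ).2 h.one_lt_sigma) hα
  rw [mu0]
  linarith

/-- Since `σ > 1`, a factor `e^(-s) ≤ e^(-t)` can be split off while the remaining weight
`e^(-(σ-1)s) s^(α-1)` stays integrable. -/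
theorem Admissible.exists_abs_kernelK_le_exp (h : Admissible α σ γ) :
    ∃ C : ℝ, 0 ≤ C ∧ ∀ t, 0 ≤ t → |kernelK α σ γ t| ≤ C * Real.exp (-t) := by
  have hα := h.alpha_pos
  have hσ : 0 < σ - 1 := by linarith [h.one_lt_sigma]
  have hi := integrableOn_exp_mul_rpow_div_Gamma hα hσ
  have hnn : ∀ s ∈ Ioi (0 : ℝ), 0 ≤ Real.exp (-(σ - 1) * s) * s ^ (α - 1) / Real.Gamma α := by
    intro s hs
    have := Real.Gamma_pos_of_pos hα
    have := Real.rpow_pos_of_pos (mem_Ioi.1 hs) (α - 1)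
    positivity
  refine ⟨∫ s in Ioi (0 : ℝ), Real.exp (-(σ - 1) * s) * s ^ (α - 1) / Real.Gamma α,
    setIntegral_nonneg measurableSet_Ioi hnn, fun t ht => ?_⟩
  have hsub : Ioi t ⊆ Ioi (0 : ℝ) := Ioi_subset_Ioi ht
  calc |kernelK α σ γ t| ≤ ∫ s in Ioi t, |beta α σ γ s| := abs_integral_le_integral_abs
    _ ≤ ∫ s in Ioi t,
        Real.exp (-(σ - 1) * s) * s ^ (α - 1) / Real.Gamma α * Real.exp (-t) := by
      refine setIntegral_mono_on (h.integrableOn_beta.mono_set hsub).abs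
        ((hi.mono_set hsub).mul_const _) measurableSet_Ioi fun s hs => ?_
      refine (abs_beta_le hα (hsub hs)).trans ?_
      have e : Real.exp (-σ * s) * s ^ (α - 1) / Real.Gamma α
          = Real.exp (-(σ - 1) * s) * s ^ (α - 1) / Real.Gamma α * Real.exp (-s) := by
        rw [show -σ * s = -(σ - 1) * s + -s by ring, Real.exp_add]; ring
      rw [e]
      refine mul_le_mul_of_nonneg_left (Real.exp_le_exp.2 ?_) (hnn s (hsub hs))
      exact neg_le_neg (le_of_lt hs)
    _ ≤ _ := by
      rw [integral_mul_const]
      refine mul_le_mul_of_nonneg_right ?_ (Real.exp_pos _).le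
      refine setIntegral_mono_set hi ?_ hsub.eventuallyLE
      filter_upwards [ae_restrict_mem measurableSet_Ioi] with s hs using hnn s hs

theorem Admissible.integral_beta_mul_sin_nonneg (h : Admissible α σ γ) {ω : ℝ} (hω : 0 < ω) :
    0 ≤ ∫ s in Ioi (0 : ℝ), beta α σ γ s * Real.sin (ω * s) := by
  have hσ : 0 < σ := by linarith [h.one_lt_sigma]
  have hi : ∀ x, IntegrableOn (fun s => Real.exp (-σ * s) * s ^ (α - 1) * Real.sin (x * s)
      / Real.Gamma α) (Ioi 0) := by
    intro x
    have := (integrableOn_exp_mul_rpow_div_Gamma h.alpha_pos hσ).mul_bdd (c := 1)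
      (g := fun s => Real.sin (x * s)) (by fun_prop)
      (Eventually.of_forall fun s => by simpa using Real.abs_sin_le_one _)
    refine this.congr (Eventually.of_forall fun s => ?_)
    simp only
    ring
  have e : ∀ s, beta α σ γ s * Real.sin (ω * s)
      = (Real.exp (-σ * s) * s ^ (α - 1) * Real.sin ((ω + γ) * s) / Real.Gamma α
        + Real.exp (-σ * s) * s ^ (α - 1) * Real.sin ((ω - γ) * s) / Real.Gamma α) / 2 := by
    intro s
    rw [beta, add_mul, sub_mul, Real.sin_add, Real.sin_sub]
    ring
  simp_rw [e]
  rw [integral_div, integral_add (hi _) (hi _)]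
  refine div_nonneg ?_ zero_le_two
  rcases h with ⟨rfl, -, hγ, hγσ⟩ | ⟨rfl, -, hγ, hγσ⟩
  · rw [integral_exp_mul_sin_one hσ, integral_exp_mul_sin_one hσ, im_one_div_sub_mul_I,
      im_one_div_sub_mul_I]
    exact div_add_div_nonneg_of_le hσ hγ hγσ hω
  · rw [integral_exp_mul_sin_half hσ, integral_exp_mul_sin_half hσ]
    exact im_cpow_half_add_nonneg hσ hγ hγσ hω

theorem Admissible.continuous_kernelK_abs (h : Admissible α σ γ) :
    Continuous fun t => kernelK α σ γ |t| :=
  continuous_tail_abs h.integrableOn_beta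

theorem Admissible.integrable_kernelK_abs (h : Admissible α σ γ) :
    Integrable fun t => kernelK α σ γ |t| := by
  obtain ⟨C, hC0, hC⟩ := h.exists_abs_kernelK_le_exp
  refine Integrable.mono' ((integrable_inv_one_add_sq.const_mul 2).const_mul C)
    h.continuous_kernelK_abs.aestronglyMeasurable
    (Eventually.of_forall fun t => (hC _ (abs_nonneg t)).trans ?_)
  refine mul_le_mul_of_nonneg_left ?_ hC0
  rw [Real.exp_neg, ← div_eq_mul_inv, ← one_div, div_le_div_iff₀ (Real.exp_pos _) (by positivity)]
  have := Real.quadratic_le_exp_of_nonneg (abs_nonneg t)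
  rw [sq_abs] at this
  linarith [abs_nonneg t]

theorem Admissible.integral_kernelK_abs_mul_cos_nonneg (h : Admissible α σ γ) {ω : ℝ}
    (hω : 0 < ω) : 0 ≤ ∫ u, kernelK α σ γ |u| * Real.cos (ω * u) := by
  have e : ∀ u, kernelK α σ γ |u| * Real.cos (ω * u)
      = kernelK α σ γ |u| * Real.cos (ω * |u|) := by
    intro u
    rcases abs_cases u with ⟨h, -⟩ | ⟨h, -⟩ <;> simp [h]
  simp_rw [e]
  rw [integral_comp_abs (f := fun u => kernelK α σ γ u * Real.cos (ω * u))]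
  have hK : IntegrableOn (kernelK α σ γ) (Ioi 0) :=
    h.integrable_kernelK_abs.integrableOn.congr_fun
      (fun t ht => by simp only; rw [abs_of_pos ht]) measurableSet_Ioi
  have := integral_tail_mul_cos h.integrableOn_beta continuousOn_beta hK hω.ne'
  simp only [kernelK]
  rw [this]
  have := h.integral_beta_mul_sin_nonneg hω
  positivity

/-! ### The quadrature weights -/

/-- For these indices the whole hat lies inside `[0, t_n]`, where the argument of `K` is
nonnegative. -/
theorem kappa_of_lt {τ : ℝ} (hτ : 0 < τ) {n p : ℕ} (hp : 1 ≤ p) (hpn : p < n) :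
    kappa α σ γ τ n p
      = ∫ s, kernelK α σ γ |(n : ℝ) * τ - p * τ - s| * max (1 - |s / τ|) 0 := by
  have h1 : (1 : ℝ) ≤ p := by exact_mod_cast hp
  have h2 : (1 : ℝ) ≤ (n - p : ℕ) := by exact_mod_cast Nat.le_sub_of_add_le' (by omega)
  have h3 : ((n - p : ℕ) : ℝ) = n - p := by rw [Nat.cast_sub hpn.le]
  rw [kappa, min_eq_left (by nlinarith), min_eq_left (by nlinarith),
    intervalIntegral.integral_of_le (by linarith)]
  refine Eq.trans ?_ (setIntegral_eq_integral_of_forall_compl_eq_zero (s := Ioc (-τ) τ) ?_)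
  · refine setIntegral_congr_fun (measurableSet_Ioc (a := -τ) (b := τ)) fun s hs => ?_
    have hs2 : s ≤ τ := hs.2
    rw [abs_of_nonneg (a := (n : ℝ) * τ - p * τ - s) (by rw [h3] at h2; nlinarith), h3, sub_mul]
  · intro s hs
    have : τ ≤ |s| := by
      by_contra! hlt
      exact hs ⟨(abs_lt.1 hlt).1, (abs_lt.1 hlt).2.le⟩
    rw [hat_eq_zero hτ this, mul_zero]

/-- Only the left half of the last hat lies in `[0, t_n]`; evenness supplies the other half. -/
theorem kappa_self {τ : ℝ} (hτ : 0 < τ) {n : ℕ} (hn : 1 ≤ n) :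
    2 * kappa α σ γ τ n n = ∫ s, kernelK α σ γ |s| * max (1 - |s / τ|) 0 := by
  have h1 : (1 : ℝ) ≤ n := by exact_mod_cast hn
  have e : ∀ s : ℝ, kernelK α σ γ |s| * max (1 - |s / τ|) 0
      = (fun s => kernelK α σ γ s * max (1 - |s / τ|) 0) |s| := by
    intro s
    simp only [abs_div, abs_abs]
  rw [integral_congr_ae (Eventually.of_forall e),
    integral_comp_abs (f := fun s => kernelK α σ γ s * max (1 - |s / τ|) 0), kappa, min_eq_left (by nlinarith), Nat.sub_self, Nat.cast_zero, zero_mul,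
    min_eq_right hτ.le]
  congr 1
  have hz : ∫ s in Ioi (0 : ℝ), kernelK α σ γ s * max (1 - |s / τ|) 0
      = ∫ s in Ioc (0 : ℝ) τ, kernelK α σ γ s * max (1 - |s / τ|) 0 := by
    refine setIntegral_eq_of_subset_of_forall_sdiff_eq_zero measurableSet_Ioi
      Ioc_subset_Ioi_self fun x hx => ?_
    have : τ < x := by
      by_contra! h
      exact hx.2 ⟨hx.1, h⟩
    rw [hat_eq_zero hτ (this.le.trans (le_abs_self x)), mul_zero]
  rw [hz, ← intervalIntegral.integral_of_le hτ.le]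
  have := intervalIntegral.integral_comp_neg (a := -τ) (b := 0)
    (fun s => kernelK α σ γ s * max (1 - |s / τ|) 0)
  rw [neg_neg, neg_zero] at this
  rw [← this]
  simp [neg_div]

/-- The memory term of the scheme is dissipative. -/
theorem Admissible.sum_sum_kappa_mul_inner_nonneg (h : Admissible α σ γ) {H : Type*}
    [NormedAddCommGroup H] [InnerProductSpace ℝ H] {τ : ℝ} (hτ : 0 < τ) (m : ℕ) (φ : ℕ → H) :
    0 ≤ ∑ n ∈ Finset.Icc 1 m, ∑ p ∈ Finset.Icc 1 n,
      kappa α σ γ τ n p * inner ℝ (φ p) (φ n) := by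
  set W : ℕ → ℕ → ℝ := fun n p =>
    (∫ s, kernelK α σ γ |(n : ℝ) * τ - p * τ - s| * max (1 - |s / τ|) 0) * inner ℝ (φ p) (φ n)
    with hW
  have hsymm : ∀ n p, W n p = W p n := by
    intro n p
    simp only [hW]
    rw [real_inner_comm, ← integral_neg_eq_self]
    congr 1
    refine integral_congr_ae (Eventually.of_forall fun s => ?_)
    simp only
    rw [neg_div, abs_neg, ← abs_neg]
    congr 3
    ring
  have hnn : ∀ m, 0 ≤ ∑ n ∈ Finset.Icc 1 m, ∑ p ∈ Finset.Icc 1 m, W n p := fun m =>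
    sum_sum_integral_hat_mul_inner_nonneg (F := fun t => kernelK α σ γ |t|) hτ
      h.integrable_kernelK_abs (fun x => by rw [abs_neg])
      (fun ω hω => h.integral_kernelK_abs_mul_cos_nonneg hω) (Finset.Icc 1 m) φ
  -- Enlarging the square by one adds a row, an equal column and a corner. The halved diagonal
  -- weight is what makes the corner match. Index `0` is left out: its half hat does not fit the
  -- Toeplitz pattern.
  have hdouble : ∀ m, 2 * ∑ n ∈ Finset.Icc 1 m, ∑ p ∈ Finset.Icc 1 n,
      kappa α σ γ τ n p * inner ℝ (φ p) (φ n)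
      = ∑ n ∈ Finset.Icc 1 m, ∑ p ∈ Finset.Icc 1 m, W n p := by
    intro m
    induction m with
    | zero => simp
    | succ m ih =>
      have hm : 1 ≤ m + 1 := by omega
      simp only [Finset.sum_Icc_succ_top hm, Finset.sum_add_distrib, mul_add]
      rw [ih]
      have hself : 2 * (kappa α σ γ τ (m + 1) (m + 1) * inner ℝ (φ (m + 1)) (φ (m + 1)))
          = W (m + 1) (m + 1) := by
        rw [← mul_assoc, kappa_self hτ hm]
        simp only [hW]
        rw [sub_self, ← integral_neg_eq_self]
        simp [neg_div]
      have hlt : ∑ p ∈ Finset.Icc 1 m,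
            kappa α σ γ τ (m + 1) p * inner ℝ (φ p) (φ (m + 1))
          = ∑ p ∈ Finset.Icc 1 m, W (m + 1) p := by
        refine Finset.sum_congr rfl fun p hp => ?_
        rw [Finset.mem_Icc] at hp
        rw [kappa_of_lt hτ hp.1 (by omega)]
      have hs : ∑ n ∈ Finset.Icc 1 m, W n (m + 1) = ∑ p ∈ Finset.Icc 1 m, W (m + 1) p :=
        Finset.sum_congr rfl fun p _ => hsymm _ _
      rw [hself, hlt, hs]
      ring
  have := hnn m
  rw [← hdouble m] at this
  linarith

/-- The diagonal weight is the same for all `n ≥ 1`, and for `n = 1` it is the form with a single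
scalar entry. -/
theorem Admissible.kappa_self_nonneg (h : Admissible α σ γ) {τ : ℝ} (hτ : 0 < τ) {n : ℕ}
    (hn : 1 ≤ n) : 0 ≤ kappa α σ γ τ n n := by
  have h1 := h.sum_sum_kappa_mul_inner_nonneg hτ 1 (fun _ => (1 : ℝ))
  have h2 := kappa_self (α := α) (σ := σ) (γ := γ) hτ le_rfl
  have h3 := kappa_self (α := α) (σ := σ) (γ := γ) hτ hn
  simp at h1
  linarith

/-- The weights of the initial velocity are summable, uniformly in the time step. -/
theorem Admissible.exists_sum_abs_kappa_zero_le (h : Admissible α σ γ) :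
    ∃ C : ℝ, 0 ≤ C ∧ ∀ τ : ℝ, 0 < τ → ∀ m : ℕ,
      ∑ n ∈ Finset.Icc 1 m, |kappa α σ γ τ n 0| ≤ C := by
  obtain ⟨C, hC0, hC⟩ := h.exists_abs_kernelK_le_exp
  refine ⟨C, hC0, fun τ hτ m => ?_⟩
  -- Integrating the exponential bound over one cell gives a difference of consecutive values, which
  -- telescopes.
  have hterm : ∀ n : ℕ, |kappa α σ γ τ (n + 1) 0|
      ≤ C * (Real.exp (-(n * τ)) - Real.exp (-((n + 1 : ℕ) * τ))) := by
    intro n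
    have h1 : (1 : ℝ) ≤ (n + 1 : ℕ) := by exact_mod_cast Nat.le_add_left 1 n
    rw [kappa, Nat.cast_zero, zero_mul, min_eq_right hτ.le, neg_zero, Nat.sub_zero,
      min_eq_left (by nlinarith)]
    have hb : ∀ s ∈ Ioc (0 : ℝ) τ,
        ‖kernelK α σ γ ((n + 1 : ℕ) * τ - s) * max (1 - |s / τ|) 0‖
          ≤ C * Real.exp (s - (n + 1 : ℕ) * τ) := by
      intro s hs
      rw [norm_mul, Real.norm_eq_abs, Real.norm_of_nonneg (le_max_right _ _)]
      have h2 := hC ((n + 1 : ℕ) * τ - s) (by nlinarith [hs.2])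
      rw [neg_sub] at h2
      exact (mul_le_of_le_one_right (abs_nonneg _) (hat_le_one τ s)).trans h2
    have hle := intervalIntegral.norm_integral_le_of_norm_le (μ := volume)
      (g := fun s => C * Real.exp (s - (n + 1 : ℕ) * τ)) hτ.le
      (ae_of_all _ hb)
      ((by fun_prop : Continuous fun s : ℝ =>
        C * Real.exp (s - (n + 1 : ℕ) * τ)).intervalIntegrable _ _)
    rw [Real.norm_eq_abs] at hle
    refine hle.trans_eq ?_
    rw [intervalIntegral.integral_const_mul,
      intervalIntegral.integral_comp_sub_right (fun x => Real.exp x), integral_exp]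
    congr 3 <;> push_cast <;> ring
  have htel : ∀ m : ℕ, ∑ n ∈ Finset.Icc 1 m, |kappa α σ γ τ n 0|
      ≤ C * (1 - Real.exp (-(m * τ))) := by
    intro m
    induction m with
    | zero => simp
    | succ m ih =>
      rw [Finset.sum_Icc_succ_top (by omega)]
      linarith [hterm m]
  refine (htel m).trans (mul_le_of_le_one_right hC0 ?_)
  linarith [Real.exp_pos (-((m : ℝ) * τ))]

/-- The kernel has bounded variation along every time grid, uniformly in the time step. -/
theorem Admissible.exists_kernelK_variation_le (h : Admissible α σ γ) :
    ∃ D : ℝ, 0 ≤ D ∧ (∀ t, 0 ≤ t → |kernelK α σ γ t| ≤ D) ∧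
      ∀ τ : ℝ, 0 < τ → ∀ m : ℕ,
        ∑ n ∈ Finset.range m, |kernelK α σ γ (n * τ) - kernelK α σ γ ((n + 1 : ℕ) * τ)| ≤ D := by
  set A : ℝ → ℝ := fun t => ∫ x in Ioi t, |beta α σ γ x| with hA
  have hA0 : ∀ t, 0 ≤ A t := fun t => integral_nonneg fun x => abs_nonneg _
  refine ⟨A 0, hA0 0, fun t ht => abs_tail_le h.integrableOn_beta ht, fun τ hτ m => ?_⟩
  have htel : ∑ n ∈ Finset.range m,
      |kernelK α σ γ (n * τ) - kernelK α σ γ ((n + 1 : ℕ) * τ)|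
      ≤ ∑ n ∈ Finset.range m, (A (n * τ) - A ((n + 1 : ℕ) * τ)) :=
    Finset.sum_le_sum fun n _ => abs_tail_sub_tail_le h.integrableOn_beta (by positivity)
      (by push_cast; nlinarith)
  rw [Finset.sum_range_sub' (fun n : ℕ => A (n * τ)) m] at htel
  refine htel.trans ?_
  simp only [Nat.cast_zero, zero_mul]
  linarith [hA0 (m * τ)]

end Kernel

/-! ### Energy estimates in inner product spaces -/

section Energy

variable {H V : Type*} [NormedAddCommGroup H] [InnerProductSpace ℝ H]
  [NormedAddCommGroup V] [InnerProductSpace ℝ V]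

/-- The centred difference scheme tested with the centred difference quotient. -/
theorem energy_step {τ : ℝ} (hτ : 0 < τ) (g μ M R : ℝ) (x y z : H) (a b c : V)
    (h : inner ℝ (τ⁻¹ • (τ⁻¹ • (z - y) - τ⁻¹ • (y - x))) ((2 * τ)⁻¹ • (z - x))
      + g * inner ℝ ((2 * τ)⁻¹ • (z - x)) ((2 * τ)⁻¹ • (z - x))
      + μ * inner ℝ ((2 : ℝ)⁻¹ • (c + a)) ((2 * τ)⁻¹ • (c - a)) + M = R) :
    (‖τ⁻¹ • (z - y)‖ ^ 2 + μ / 2 * (‖c‖ ^ 2 + ‖b‖ ^ 2))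
      - (‖τ⁻¹ • (y - x)‖ ^ 2 + μ / 2 * (‖b‖ ^ 2 + ‖a‖ ^ 2))
      + 2 * τ * (g * ‖(2 * τ)⁻¹ • (z - x)‖ ^ 2) + 2 * τ * M = 2 * τ * R := by
  have h1 : inner ℝ (τ⁻¹ • (τ⁻¹ • (z - y) - τ⁻¹ • (y - x))) ((2 * τ)⁻¹ • (z - x))
      = (2 * τ)⁻¹ * (‖τ⁻¹ • (z - y)‖ ^ 2 - ‖τ⁻¹ • (y - x)‖ ^ 2) := by
    -- The centred quotient is the mean of the two one-sided ones, so the product is a difference of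
    -- squares. The `‖b‖²` terms cancel between the two energies.
    have e : (2 * τ)⁻¹ • (z - x) = (2 : ℝ)⁻¹ • (τ⁻¹ • (z - y) + τ⁻¹ • (y - x)) := by
      rw [← smul_add, sub_add_sub_cancel, smul_smul, mul_inv]
    rw [e]
    generalize τ⁻¹ • (z - y) = p
    generalize τ⁻¹ • (y - x) = q
    rw [real_inner_smul_left, real_inner_smul_right, inner_sub_left, inner_add_right,
      inner_add_right, real_inner_self_eq_norm_sq, real_inner_self_eq_norm_sq,
      real_inner_comm p q, mul_inv]
    ring
  have h2 : inner ℝ ((2 : ℝ)⁻¹ • (c + a)) ((2 * τ)⁻¹ • (c - a))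
      = (4 * τ)⁻¹ * (‖c‖ ^ 2 - ‖a‖ ^ 2) := by
    rw [real_inner_smul_left, real_inner_smul_right, inner_add_left, inner_sub_right,
      inner_sub_right, real_inner_self_eq_norm_sq, real_inner_self_eq_norm_sq,
      real_inner_comm c a, show (4 * τ) = 2 * (2 * τ) by ring, mul_inv 2 (2 * τ)]
    ring
  rw [h1, h2, real_inner_self_eq_norm_sq] at h
  rw [← h]
  field_simp
  ring

theorem sum_smul_sub_eq (k : ℕ → ℝ) (v : ℕ → V) (m : ℕ) :
    ∑ n ∈ Finset.Icc 1 m, k n • (v n - v (n - 1))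
      = k m • v m - k 0 • v 0 + ∑ n ∈ Finset.range m, (k n - k (n + 1)) • v n := by
  induction m with
  | zero => simp
  | succ m ih =>
    rw [Finset.sum_Icc_succ_top (by omega), ih, Finset.sum_range_succ, Nat.add_sub_cancel]
    module

/-- Summation by parts leaves two boundary terms and a variation term, each at most `D * B`. -/
theorem norm_sum_smul_sub_le {k : ℕ → ℝ} {v : ℕ → V} {m : ℕ} {B D : ℝ} (hB : 0 ≤ B)
    (hk : ∀ n, |k n| ≤ D) (hvar : ∑ n ∈ Finset.range m, |k n - k (n + 1)| ≤ D)
    (hv : ∀ n ≤ m, ‖v n‖ ≤ B) :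
    ‖∑ n ∈ Finset.Icc 1 m, k n • (v n - v (n - 1))‖ ≤ 3 * D * B := by
  have hD : 0 ≤ D := (abs_nonneg _).trans (hk 0)
  have h1 : ∀ n ≤ m, ‖k n • v n‖ ≤ D * B := fun n hn => by
    rw [norm_smul, Real.norm_eq_abs]
    exact mul_le_mul (hk n) (hv n hn) (norm_nonneg _) hD
  have h2 : ‖∑ n ∈ Finset.range m, (k n - k (n + 1)) • v n‖ ≤ D * B := by
    refine (norm_sum_le _ _).trans (le_trans ?_ (mul_le_mul_of_nonneg_right hvar hB))
    rw [Finset.sum_mul]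
    refine Finset.sum_le_sum fun n hn => ?_
    rw [norm_smul, Real.norm_eq_abs]
    exact mul_le_mul_of_nonneg_left (hv n (Finset.mem_range.1 hn).le) (abs_nonneg _)
  rw [sum_smul_sub_eq]
  have h3 := norm_add_le (k m • v m - k 0 • v 0) (∑ n ∈ Finset.range m, (k n - k (n + 1)) • v n)
  have h4 := norm_sub_le (k m • v m) (k 0 • v 0)
  linarith [h1 m le_rfl, h1 0 (Nat.zero_le m)]

end Energy

section Scheme

variable {d : ℕ} {Ω : Set (EuclideanSpace ℝ (Fin d))} {Sh : Submodule ℝ (H10 Ω)}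

theorem fn_add (v w : Sh) : fn (v + w) = fn v + fn w := rfl
theorem fn_sub (v w : Sh) : fn (v - w) = fn v - fn w := rfl
theorem fn_smul (c : ℝ) (v : Sh) : fn (c • v) = c • fn v := rfl
theorem grad_add (v w : Sh) : grad (v + w) = grad v + grad w := rfl
theorem grad_sub (v w : Sh) : grad (v - w) = grad v - grad w := rfl
theorem grad_smul (c : ℝ) (v : Sh) : grad (c • v) = c • grad v := rfl

theorem eq_zero_of_fn_of_grad {v : Sh} (h1 : fn v = 0) (h2 : grad v = 0) : v = 0 :=
  Subtype.ext (Subtype.ext (Prod.ext h1 h2))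

/-! ### Solvability of one time step -/

theorem surjective_of_injective_dual {E : Type*} [AddCommGroup E] [Module ℝ E]
    [FiniteDimensional ℝ E] (B : E →ₗ[ℝ] Module.Dual ℝ E) (hB : Function.Injective B) :
    Function.Surjective B :=
  (LinearMap.injective_iff_surjective_of_finrank_eq_finrank
    Subspace.dual_finrank_eq.symm).1 hB

/-- The form is positive definite, so it embeds the space in its dual; equal dimensions make this
onto. -/
theorem existsUnique_inner_fn_add_inner_grad [FiniteDimensional ℝ Sh] {c₁ c₂ : ℝ}
    (hc₁ : 0 < c₁) (hc₂ : 0 < c₂) (X : L2 Ω) (Y : L2vec Ω) :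
    ∃! z : Sh, ∀ ψ : Sh, c₁ * inner ℝ (fn z) (fn ψ) + c₂ * inner ℝ (grad z) (grad ψ)
      = inner ℝ X (fn ψ) + inner ℝ Y (grad ψ) := by
  let B : Sh →ₗ[ℝ] Module.Dual ℝ Sh := LinearMap.mk₂ ℝ
    (fun z ψ => c₁ * inner ℝ (fn z) (fn ψ) + c₂ * inner ℝ (grad z) (grad ψ))
    (fun x y z => by simp only [fn_add, grad_add, inner_add_left]; ring)
    (fun c x y => by
      simp only [fn_smul, grad_smul, real_inner_smul_left, smul_eq_mul]; ring)
    (fun x y z => by simp only [fn_add, grad_add, inner_add_right]; ring)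
    (fun c x y => by
      simp only [fn_smul, grad_smul, real_inner_smul_right, smul_eq_mul]; ring)
  let ℓ : Module.Dual ℝ Sh :=
    { toFun := fun ψ => inner ℝ X (fn ψ) + inner ℝ Y (grad ψ)
      map_add' := fun x y => by simp only [fn_add, grad_add, inner_add_right]; ring
      map_smul' := fun c x => by
        simp only [fn_smul, grad_smul, real_inner_smul_right, smul_eq_mul, RingHom.id_apply]
        ring }
  have hinj : Function.Injective B := by
    rw [injective_iff_map_eq_zero]
    intro z hz
    have h0 : c₁ * inner ℝ (fn z) (fn z) + c₂ * inner ℝ (grad z) (grad z) = 0 :=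
      congrArg (fun L : Module.Dual ℝ Sh => L z) hz
    rw [real_inner_self_eq_norm_sq, real_inner_self_eq_norm_sq] at h0
    have h1 : 0 ≤ c₁ * ‖fn z‖ ^ 2 := by positivity
    have h2 : 0 ≤ c₂ * ‖grad z‖ ^ 2 := by positivity
    refine eq_zero_of_fn_of_grad (norm_eq_zero.1 ?_) (norm_eq_zero.1 ?_)
    · exact pow_eq_zero_iff two_ne_zero |>.1
        ((mul_eq_zero.1 (le_antisymm (by linarith) h1)).resolve_left hc₁.ne')
    · exact pow_eq_zero_iff two_ne_zero |>.1
        ((mul_eq_zero.1 (le_antisymm (by linarith) h2)).resolve_left hc₂.ne')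
  have hsurj : Function.Surjective B := surjective_of_injective_dual (E := Sh) B hinj
  obtain ⟨z, hz⟩ := hsurj ℓ
  refine ⟨z, fun ψ => congrArg (fun L : Module.Dual ℝ Sh => L ψ) hz, fun y hy => hinj ?_⟩
  rw [hz]
  exact LinearMap.ext hy

variable {α σ γ : ℝ} {G : ℝ → ℝ} {μ₁ μ₂ ε τ : ℝ} {f : ℝ → L2 Ω} {u1h : Sh}

/-- The `L²` load of a time step, collecting the terms given by the preceding time levels. -/
def loadFn (G : ℝ → ℝ) (μ₁ μ₂ τ : ℝ) (f : ℝ → L2 Ω) (U : ℕ → Sh) (n : ℕ) : L2 Ω :=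
  f (n * τ) + τ⁻¹ • (τ⁻¹ • fn (U n) + fn (deltaT τ U n))
    + (G (μ₁ * ‖fn (U n)‖ ^ 2 + μ₂ * ‖grad (U n)‖ ^ 2) * (2 * τ)⁻¹) • fn (U (n - 1))

/-- The gradient load of a time step, collecting the terms given by the preceding time levels. -/
def loadGrad (α σ γ ε τ : ℝ) (u1h : Sh) (U : ℕ → Sh) (n : ℕ) : L2vec Ω :=
  (ε * kernelK α σ γ (n * τ)) • grad (U 0)
    + (kappa α σ γ τ n n * (2 * τ)⁻¹ - mu0 α σ γ / 2) • grad (U (n - 1))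
    - ∑ p ∈ Finset.range n, kappa α σ γ τ n p • grad (deltaBar τ u1h U p)

/-- The only implicit part of the memory sum is its last term, through `U^{n+1}` in `δ̄U^n`; every
earlier `δ̄U^p` involves levels up to `n` at most. -/
theorem schemeAt_iff {U : ℕ → Sh} {n : ℕ} (hn : 1 ≤ n) :
    SchemeAt α σ γ G μ₁ μ₂ ε τ f u1h U n ↔ ∀ ψ : Sh,
      (τ⁻¹ * τ⁻¹ + G (μ₁ * ‖fn (U n)‖ ^ 2 + μ₂ * ‖grad (U n)‖ ^ 2) * (2 * τ)⁻¹)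
          * inner ℝ (fn (U (n + 1))) (fn ψ)
        + (mu0 α σ γ / 2 + kappa α σ γ τ n n * (2 * τ)⁻¹)
          * inner ℝ (grad (U (n + 1))) (grad ψ)
      = inner ℝ (loadFn G μ₁ μ₂ τ f U n) (fn ψ)
        + inner ℝ (loadGrad α σ γ ε τ u1h U n) (grad ψ) := by
  refine forall_congr' fun ψ => ?_
  rw [Finset.sum_range_succ]
  have hn0 : n ≠ 0 := by omega
  have e1 : fn (deltaT2 τ U n) = τ⁻¹ • (τ⁻¹ • (fn (U (n + 1)) - fn (U n)) - fn (deltaT τ U n)) :=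
    rfl
  have e2 : deltaBar τ u1h U n = (2 * τ)⁻¹ • (U (n + 1) - U (n - 1)) := if_neg hn0
  have e3 : grad (avg U n) = (2 : ℝ)⁻¹ • (grad (U (n + 1)) + grad (U (n - 1))) := rfl
  rw [e1, e2, e3, fn_smul, fn_sub, grad_smul, grad_sub, loadFn, loadGrad]
  simp only [inner_add_left, inner_sub_left, real_inner_smul_left, sum_inner]
  constructor <;> intro h <;> linear_combination h

theorem loadFn_congr {U V : ℕ → Sh} {n : ℕ} (h : ∀ k ≤ n, U k = V k) :
    loadFn G μ₁ μ₂ τ f U n = loadFn G μ₁ μ₂ τ f V n := by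
  simp only [loadFn, deltaT, h n le_rfl, h (n - 1) (Nat.sub_le _ _)]

theorem loadGrad_congr {U V : ℕ → Sh} {n : ℕ} (h : ∀ k ≤ n, U k = V k) :
    loadGrad α σ γ ε τ u1h U n = loadGrad α σ γ ε τ u1h V n := by
  rw [loadGrad, loadGrad, h 0 (Nat.zero_le _), h (n - 1) (Nat.sub_le _ _)]
  congr 1
  refine Finset.sum_congr rfl fun p hp => ?_
  have hp := Finset.mem_range.1 hp
  rw [deltaBar, deltaBar, h (p + 1) hp, h (p - 1) (by omega)]

theorem schemeAt_congr {U V : ℕ → Sh} {n : ℕ} (hn : 1 ≤ n) (h : ∀ k ≤ n + 1, U k = V k) :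
    SchemeAt α σ γ G μ₁ μ₂ ε τ f u1h U n ↔ SchemeAt α σ γ G μ₁ μ₂ ε τ f u1h V n := by
  have h' : ∀ k ≤ n, U k = V k := fun k hk => h k (by omega)
  rw [schemeAt_iff hn, schemeAt_iff hn, loadFn_congr h', loadGrad_congr h', h' n le_rfl,
    h (n + 1) le_rfl]

theorem Admissible.existsUnique_step (hβ : Admissible α σ γ) [FiniteDimensional ℝ Sh]
    (hG : AssumptionA1 G) (hμ₁ : 0 ≤ μ₁) (hμ₂ : 0 ≤ μ₂) (hτ : 0 < τ) {n : ℕ} (hn : 1 ≤ n)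
    (U : ℕ → Sh) :
    ∃! z : Sh, ∀ ψ : Sh,
      (τ⁻¹ * τ⁻¹ + G (μ₁ * ‖fn (U n)‖ ^ 2 + μ₂ * ‖grad (U n)‖ ^ 2) * (2 * τ)⁻¹)
          * inner ℝ (fn z) (fn ψ)
        + (mu0 α σ γ / 2 + kappa α σ γ τ n n * (2 * τ)⁻¹) * inner ℝ (grad z) (grad ψ)
      = inner ℝ (loadFn G μ₁ μ₂ τ f U n) (fn ψ)
        + inner ℝ (loadGrad α σ γ ε τ u1h U n) (grad ψ) := by
  obtain ⟨g₀, hg₀, hg⟩ := hG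
  have h1 := hg (μ₁ * ‖fn (U n)‖ ^ 2 + μ₂ * ‖grad (U n)‖ ^ 2) (by positivity)
  have h2 : 0 < G (μ₁ * ‖fn (U n)‖ ^ 2 + μ₂ * ‖grad (U n)‖ ^ 2) := hg₀.trans_le h1
  have h3 := hβ.kappa_self_nonneg hτ hn
  have h4 := hβ.mu0_pos
  exact existsUnique_inner_fn_add_inner_grad (by positivity) (by positivity) _ _

theorem Admissible.exists_isSolution (hβ : Admissible α σ γ) [FiniteDimensional ℝ Sh]
    (hG : AssumptionA1 G) (hμ₁ : 0 ≤ μ₁) (hμ₂ : 0 ≤ μ₂) (hτ : 0 < τ) (T : ℝ)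
    (u0h u1h u2h : Sh) :
    ∃ U : ℕ → Sh, IsSolution α σ γ G μ₁ μ₂ ε T τ f u0h u1h u2h U := by
  -- Each induction step overwrites entry `N + 2`. The equations at levels up to `N` see only
  -- entries up to `N + 1`, so they persist.
  have main : ∀ N : ℕ, ∃ U : ℕ → Sh, U 0 = u0h ∧ U 1 = u0h + τ • u1h + (τ ^ 2 / 2) • u2h ∧
      ∀ n : ℕ, 1 ≤ n → n ≤ N → SchemeAt α σ γ G μ₁ μ₂ ε τ f u1h U n := by
    intro N
    induction N with
    | zero =>
      exact ⟨fun n => if n = 0 then u0h else u0h + τ • u1h + (τ ^ 2 / 2) • u2h, by simp, by simp,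
        fun n h1 h2 => by omega⟩
    | succ N ih =>
      obtain ⟨U, h0, h1, hU⟩ := ih
      obtain ⟨z, hz, -⟩ := hβ.existsUnique_step (ε := ε) (f := f) (u1h := u1h) hG hμ₁ hμ₂ hτ
        (n := N + 1) (by omega) U
      have hagree : ∀ k ≤ N + 1, Function.update U (N + 2) z k = U k := fun k hk =>
        Function.update_of_ne (by omega) _ _
      refine ⟨Function.update U (N + 2) z, by rw [hagree 0 (by omega), h0],
        by rw [hagree 1 (by omega), h1], fun n hn1 hn2 => ?_⟩
      rcases Nat.lt_or_ge n (N + 1) with h | h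
      · rw [schemeAt_congr hn1 fun k hk => hagree k (by omega)]
        exact hU n hn1 (by omega)
      · obtain rfl : n = N + 1 := by omega
        rw [schemeAt_iff hn1, loadFn_congr hagree, loadGrad_congr hagree, hagree _ le_rfl,
          Function.update_self]
        exact hz
  obtain ⟨U, h0, h1, hU⟩ := main ⌊T / τ⌋₊
  exact ⟨U, h0, h1, fun n hn hnT => hU n hn (Nat.le_floor hnT)⟩

theorem Admissible.isSolution_unique (hβ : Admissible α σ γ) [FiniteDimensional ℝ Sh]
    (hG : AssumptionA1 G) (hμ₁ : 0 ≤ μ₁) (hμ₂ : 0 ≤ μ₂) (hτ : 0 < τ) {T : ℝ} (hT : 0 < T)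
    {u0h u1h u2h : Sh} {U V : ℕ → Sh}
    (hU : IsSolution α σ γ G μ₁ μ₂ ε T τ f u0h u1h u2h U)
    (hV : IsSolution α σ γ G μ₁ μ₂ ε T τ f u0h u1h u2h V) :
    ∀ n : ℕ, n ≤ ⌊T / τ⌋₊ + 1 → U n = V n := by
  intro n
  induction n using Nat.strong_induction_on with
  | _ n ih =>
    intro hn
    rcases n with _ | _ | n
    · rw [hU.1, hV.1]
    · rw [zero_add, hU.2.1, hV.2.1]
    · have hle : ((n + 1 : ℕ) : ℝ) ≤ T / τ :=
        (Nat.le_floor_iff (div_pos hT hτ).le).1 (by omega)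
      have hagree : ∀ k ≤ n + 1, V k = U k := fun k hk => (ih k (by omega) (by omega)).symm
      have h1 := (schemeAt_iff (by omega)).1 (hU.2.2 (n + 1) (by omega) hle)
      have h2 := (schemeAt_iff (by omega)).1 (hV.2.2 (n + 1) (by omega) hle)
      rw [loadFn_congr hagree, loadGrad_congr hagree, hagree _ le_rfl] at h2
      exact (hβ.existsUnique_step hG hμ₁ hμ₂ hτ (by omega) U).unique h1 h2

/-! ### Stability -/

theorem sq_normA (hμ : 0 ≤ mu0 α σ γ) (U : ℕ → Sh) (m : ℕ) :
    normA α σ γ τ U m ^ 2 = ‖fn (deltaT τ U (m + 1))‖ ^ 2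
      + mu0 α σ γ / 2 * (‖grad (U (m + 1))‖ ^ 2 + ‖grad (U m)‖ ^ 2) :=
  Real.sq_sqrt (by positivity)

theorem norm_fn_deltaT_le_normA (hμ : 0 ≤ mu0 α σ γ) (U : ℕ → Sh) (m : ℕ) :
    ‖fn (deltaT τ U (m + 1))‖ ≤ normA α σ γ τ U m :=
  Real.le_sqrt_of_sq_le (le_add_of_nonneg_right (by positivity))

theorem norm_grad_le_normA (hμ : 0 < mu0 α σ γ) (U : ℕ → Sh) (m : ℕ) :
    ‖grad (U m)‖ ≤ √(2 / mu0 α σ γ) * normA α σ γ τ U m ∧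
      ‖grad (U (m + 1))‖ ≤ √(2 / mu0 α σ γ) * normA α σ γ τ U m := by
  have e : ∀ a b c : ℝ, 2 / mu0 α σ γ * (a ^ 2 + mu0 α σ γ / 2 * (b ^ 2 + c ^ 2))
      = 2 / mu0 α σ γ * a ^ 2 + b ^ 2 + c ^ 2 := by
    intro a b c
    field_simp
    ring
  rw [normA, ← Real.sqrt_mul (by positivity), e]
  constructor <;> refine Real.le_sqrt_of_sq_le ?_
  · exact le_add_of_nonneg_left (by positivity)
  · linarith [sq_nonneg ‖grad (U m)‖,
      (by positivity : 0 ≤ 2 / mu0 α σ γ * ‖fn (deltaT τ U (m + 1))‖ ^ 2)]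

theorem sq_normA_sub_sq_normA_le (hμ : 0 ≤ mu0 α σ γ) (hG : AssumptionA1 G) (hμ₁ : 0 ≤ μ₁)
    (hμ₂ : 0 ≤ μ₂) (hτ : 0 < τ) {U : ℕ → Sh} {n : ℕ}
    (h : SchemeAt α σ γ G μ₁ μ₂ ε τ f u1h U (n + 1)) :
    normA α σ γ τ U (n + 1) ^ 2 - normA α σ γ τ U n ^ 2
      + 2 * τ * ∑ p ∈ Finset.Icc 1 (n + 1), kappa α σ γ τ (n + 1) p
          * inner ℝ (grad (deltaBar τ u1h U p)) (grad (deltaBar τ u1h U (n + 1)))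
      ≤ 2 * τ * (inner ℝ (f ((n + 1 : ℕ) * τ)) (fn (deltaBar τ u1h U (n + 1)))
        + ε * (kernelK α σ γ ((n + 1 : ℕ) * τ)
          * inner ℝ (grad (U 0)) (grad (deltaBar τ u1h U (n + 1))))
        - kappa α σ γ τ (n + 1) 0
          * inner ℝ (grad u1h) (grad (deltaBar τ u1h U (n + 1)))) := by
  obtain ⟨g₀, hg₀, hg⟩ := hG
  have hg1 := hg (μ₁ * ‖fn (U (n + 1))‖ ^ 2 + μ₂ * ‖grad (U (n + 1))‖ ^ 2) (by positivity)
  have heq := energy_step hτ _ (mu0 α σ γ) _ _ (fn (U n)) (fn (U (n + 1))) (fn (U (n + 2)))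
    (grad (U n)) (grad (U (n + 1))) (grad (U (n + 2))) (h (deltaBar τ u1h U (n + 1)))
  rw [sq_normA hμ, sq_normA hμ]
  have hsum : ∑ p ∈ Finset.range (n + 1 + 1), kappa α σ γ τ (n + 1) p
        * inner ℝ (grad (deltaBar τ u1h U p)) (grad (deltaBar τ u1h U (n + 1)))
      = kappa α σ γ τ (n + 1) 0
          * inner ℝ (grad u1h) (grad (deltaBar τ u1h U (n + 1)))
        + ∑ p ∈ Finset.Icc 1 (n + 1), kappa α σ γ τ (n + 1) p
          * inner ℝ (grad (deltaBar τ u1h U p)) (grad (deltaBar τ u1h U (n + 1))) := by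
    rw [Finset.range_eq_Ico, Finset.sum_eq_sum_Ico_succ_bot (by omega)]
    rfl
  rw [hsum] at heq
  have hpos : 0 ≤ 2 * τ * (G (μ₁ * ‖fn (U (n + 1))‖ ^ 2 + μ₂ * ‖grad (U (n + 1))‖ ^ 2)
      * ‖(2 * τ)⁻¹ • (fn (U (n + 2)) - fn (U n))‖ ^ 2) := by
    have := hg₀.trans_le hg1
    positivity
  have e1 : ‖fn (deltaT τ U (n + 1 + 1))‖ = ‖τ⁻¹ • (fn (U (n + 2)) - fn (U (n + 1)))‖ := rfl
  have e2 : ‖fn (deltaT τ U (n + 1))‖ = ‖τ⁻¹ • (fn (U (n + 1)) - fn (U n))‖ := rfl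
  rw [e1, e2]
  linarith

/-- Positivity is available for the memory form summed over all levels, so the double sum is carried
through the induction and dropped only at level `m`. -/
theorem sq_normA_le (hβ : Admissible α σ γ) (hG : AssumptionA1 G) (hμ₁ : 0 ≤ μ₁)
    (hμ₂ : 0 ≤ μ₂) (hτ : 0 < τ) {U : ℕ → Sh} {m : ℕ}
    (h : ∀ n, 1 ≤ n → n ≤ m → SchemeAt α σ γ G μ₁ μ₂ ε τ f u1h U n) :
    normA α σ γ τ U m ^ 2 ≤ normA α σ γ τ U 0 ^ 2
      + ∑ n ∈ Finset.Icc 1 m, 2 * τ * (inner ℝ (f (n * τ)) (fn (deltaBar τ u1h U n))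
        + ε * (kernelK α σ γ (n * τ) * inner ℝ (grad (U 0)) (grad (deltaBar τ u1h U n)))
        - kappa α σ γ τ n 0 * inner ℝ (grad u1h) (grad (deltaBar τ u1h U n))) := by
  have hpos := hβ.sum_sum_kappa_mul_inner_nonneg hτ m fun p => grad (deltaBar τ u1h U p)
  have hind : ∀ k ≤ m, normA α σ γ τ U k ^ 2
      + 2 * τ * ∑ n ∈ Finset.Icc 1 k, ∑ p ∈ Finset.Icc 1 n, kappa α σ γ τ n p
          * inner ℝ (grad (deltaBar τ u1h U p)) (grad (deltaBar τ u1h U n))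
      ≤ normA α σ γ τ U 0 ^ 2
      + ∑ n ∈ Finset.Icc 1 k, 2 * τ * (inner ℝ (f (n * τ)) (fn (deltaBar τ u1h U n))
        + ε * (kernelK α σ γ (n * τ) * inner ℝ (grad (U 0)) (grad (deltaBar τ u1h U n)))
        - kappa α σ γ τ n 0 * inner ℝ (grad u1h) (grad (deltaBar τ u1h U n))) := by
    intro k
    induction k with
    | zero => simp
    | succ k ih =>
      intro hk
      have hstep := sq_normA_sub_sq_normA_le hβ.mu0_pos.le hG hμ₁ hμ₂ hτ
        (h (k + 1) (by omega) hk)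
      rw [Finset.sum_Icc_succ_top (by omega)] at hstep
      rw [Finset.sum_Icc_succ_top (by omega), Finset.sum_Icc_succ_top (by omega),
        Finset.sum_Icc_succ_top (by omega)]
      linarith [ih (by omega)]
  have := hind m le_rfl
  have := mul_nonneg (by positivity : 0 ≤ 2 * τ) hpos
  linarith

theorem norm_fn_deltaBar_le (hμ : 0 ≤ mu0 α σ γ) {U : ℕ → Sh} {m : ℕ} {M : ℝ}
    (hM : ∀ k ≤ m, normA α σ γ τ U k ≤ M) {n : ℕ} (hn : 1 ≤ n) (hnm : n ≤ m) :
    ‖fn (deltaBar τ u1h U n)‖ ≤ M := by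
  obtain ⟨n, rfl⟩ : ∃ k, n = k + 1 := ⟨n - 1, by omega⟩
  have e : fn (deltaBar τ u1h U (n + 1))
      = (2 : ℝ)⁻¹ • (fn (deltaT τ U (n + 1 + 1)) + fn (deltaT τ U (n + 1))) := by
    have e1 : fn (deltaT τ U (n + 1 + 1)) = τ⁻¹ • (fn (U (n + 2)) - fn (U (n + 1))) := rfl
    have e2 : fn (deltaT τ U (n + 1)) = τ⁻¹ • (fn (U (n + 1)) - fn (U n)) := rfl
    rw [deltaBar, if_neg (Nat.succ_ne_zero n), fn_smul, fn_sub, e1, e2, ← smul_add, smul_smul,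
      ← mul_inv, sub_add_sub_cancel, Nat.add_sub_cancel]
  rw [e, norm_smul, Real.norm_of_nonneg (by positivity)]
  have h1 := norm_add_le (fn (deltaT τ U (n + 1 + 1))) (fn (deltaT τ U (n + 1)))
  have h2 := (norm_fn_deltaT_le_normA hμ U (n + 1)).trans (hM (n + 1) hnm)
  have h3 := (norm_fn_deltaT_le_normA hμ U n).trans (hM n (by omega))
  linarith

theorem grad_deltaBar {U : ℕ → Sh} {n : ℕ} (hn : 1 ≤ n) :
    grad (deltaBar τ u1h U n) = (2 * τ)⁻¹ • (grad (U (n + 1)) - grad (U (n - 1))) := by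
  rw [deltaBar, if_neg (by omega), grad_smul, grad_sub]

/-- The energy estimate, in terms of a common bound of the energies up to time level `m`. -/
theorem Admissible.exists_sq_normA_le (hβ : Admissible α σ γ) :
    ∃ C : ℝ, 0 < C ∧ ∀ {d : ℕ} {Ω : Set (EuclideanSpace ℝ (Fin d))} {Sh : Submodule ℝ (H10 Ω)}
      {G : ℝ → ℝ} {μ₁ μ₂ ε τ : ℝ} {f : ℝ → L2 Ω} {u1h : Sh} {U : ℕ → Sh} {m : ℕ} {M : ℝ},
      AssumptionA1 G → 0 ≤ μ₁ → 0 ≤ μ₂ → |ε| ≤ 1 → 0 < τ →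
      (∀ n, 1 ≤ n → n ≤ m → SchemeAt α σ γ G μ₁ μ₂ ε τ f u1h U n) →
      (∀ k ≤ m, normA α σ γ τ U k ≤ M) →
      normA α σ γ τ U m ^ 2 ≤ normA α σ γ τ U 0 ^ 2
        + M * (C * (‖grad (U 0)‖ + ‖grad u1h‖
          + τ * ∑ i ∈ Finset.range (m + 1), ‖f (i * τ)‖)) := by
  have hμ := hβ.mu0_pos
  obtain ⟨Cκ, hCκ, hκ⟩ := hβ.exists_sum_abs_kappa_zero_le
  obtain ⟨D, hD, hKD, hvar⟩ := hβ.exists_kernelK_variation_le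
  set c := √(2 / mu0 α σ γ) with hc
  have hc0 : 0 ≤ c := Real.sqrt_nonneg _
  -- The summands come from the source, the `∇U^0` term (`3D` from summation by parts times `2c`)
  -- and the initial velocity. All are fixed before the space and the step size.
  refine ⟨2 + 6 * D * c + 2 * Cκ * c, by positivity, ?_⟩
  intro d Ω Sh G μ₁ μ₂ ε τ f u1h U m M hG hμ₁ hμ₂ hε hτ hS hM
  have hM0 : 0 ≤ M := (Real.sqrt_nonneg _).trans (hM 0 (Nat.zero_le _))
  have hgrad : ∀ k ≤ m + 1, ‖grad (U k)‖ ≤ c * M := by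
    intro k hk
    rcases Nat.lt_or_ge m k with h | h
    · obtain rfl : k = m + 1 := by omega
      exact (norm_grad_le_normA hμ U m).2.trans (mul_le_mul_of_nonneg_left (hM m le_rfl) hc0)
    · exact (norm_grad_le_normA hμ U k).1.trans (mul_le_mul_of_nonneg_left (hM k h) hc0)
  have hload : ∑ n ∈ Finset.Icc 1 m, 2 * τ * inner ℝ (f (n * τ)) (fn (deltaBar τ u1h U n))
      ≤ 2 * M * (τ * ∑ i ∈ Finset.range (m + 1), ‖f (i * τ)‖) := by
    have hsub : ∑ n ∈ Finset.Icc 1 m, ‖f (n * τ)‖ ≤ ∑ i ∈ Finset.range (m + 1), ‖f (i * τ)‖ :=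
      Finset.sum_le_sum_of_subset_of_nonneg
        (fun n hn => Finset.mem_range.2 (by rw [Finset.mem_Icc] at hn; omega))
        fun n _ _ => norm_nonneg _
    calc _ ≤ ∑ n ∈ Finset.Icc 1 m, 2 * τ * M * ‖f (n * τ)‖ := by
          refine Finset.sum_le_sum fun n hn => ?_
          rw [Finset.mem_Icc] at hn
          have h1 := real_inner_le_norm (f (n * τ)) (fn (deltaBar τ u1h U n))
          have h2 := mul_le_mul_of_nonneg_left
            (norm_fn_deltaBar_le (u1h := u1h) hμ.le hM hn.1 hn.2) (norm_nonneg (f (n * τ)))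
          rw [mul_assoc (2 * τ)]
          exact mul_le_mul_of_nonneg_left (by linarith) (by positivity)
      _ ≤ _ := by
          rw [← Finset.mul_sum]
          calc _ ≤ 2 * τ * M * ∑ i ∈ Finset.range (m + 1), ‖f (i * τ)‖ :=
                mul_le_mul_of_nonneg_left hsub (by positivity)
            _ = _ := by ring
  have hvel : ∑ n ∈ Finset.Icc 1 m, 2 * τ * -(kappa α σ γ τ n 0
        * inner ℝ (grad u1h) (grad (deltaBar τ u1h U n)))
      ≤ 2 * Cκ * c * M * ‖grad u1h‖ := by
    calc _ ≤ ∑ n ∈ Finset.Icc 1 m, |kappa α σ γ τ n 0| * (2 * c * M * ‖grad u1h‖) := by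
          refine Finset.sum_le_sum fun n hn => ?_
          rw [Finset.mem_Icc] at hn
          rw [grad_deltaBar hn.1, real_inner_smul_right]
          set y := inner ℝ (grad u1h) (grad (U (n + 1)) - grad (U (n - 1))) with hy
          have e : 2 * τ * -(kappa α σ γ τ n 0 * ((2 * τ)⁻¹ * y)) = -(kappa α σ γ τ n 0 * y) := by
            field_simp
          have h1 : |y| ≤ 2 * c * M * ‖grad u1h‖ := by
            refine (abs_real_inner_le_norm _ _).trans ?_
            have h2 := norm_sub_le (grad (U (n + 1))) (grad (U (n - 1)))
            have h3 := hgrad (n + 1) (by omega)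
            have h4 := hgrad (n - 1) (by omega)
            rw [mul_comm (2 * c * M)]
            exact mul_le_mul_of_nonneg_left (by linarith) (norm_nonneg _)
          rw [e]
          refine (neg_le_abs _).trans ?_
          rw [abs_mul]
          exact mul_le_mul_of_nonneg_left h1 (abs_nonneg _)
      _ ≤ _ := by
          rw [← Finset.sum_mul]
          calc _ ≤ Cκ * (2 * c * M * ‖grad u1h‖) :=
                mul_le_mul_of_nonneg_right (hκ τ hτ m) (by positivity)
            _ = _ := by ring
  have hinit : ∑ n ∈ Finset.Icc 1 m, 2 * τ * (ε * (kernelK α σ γ (n * τ)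
        * inner ℝ (grad (U 0)) (grad (deltaBar τ u1h U n))))
      ≤ 6 * D * c * M * ‖grad (U 0)‖ := by
    -- With `v_n = ∇U^{n+1} + ∇U^n`, the difference `∇U^{n+1} - ∇U^{n-1}` equals `v_n - v_{n-1}`, a
    -- one-step difference ready for summation by parts.
    have e : ∑ n ∈ Finset.Icc 1 m, 2 * τ * (ε * (kernelK α σ γ (n * τ)
        * inner ℝ (grad (U 0)) (grad (deltaBar τ u1h U n))))
        = ε * inner ℝ (grad (U 0)) (∑ n ∈ Finset.Icc 1 m, kernelK α σ γ (n * τ)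
          • ((grad (U (n + 1)) + grad (U n)) - (grad (U (n - 1 + 1)) + grad (U (n - 1))))) := by
      rw [inner_sum, Finset.mul_sum]
      refine Finset.sum_congr rfl fun n hn => ?_
      rw [Finset.mem_Icc] at hn
      rw [grad_deltaBar hn.1, Nat.sub_add_cancel hn.1, add_sub_add_comm, add_comm,
        ← add_sub_add_comm, add_comm (grad (U n)), add_sub_add_right_eq_sub,
        real_inner_smul_right, real_inner_smul_right]
      field_simp
    have hsum := norm_sum_smul_sub_le (k := fun n => kernelK α σ γ (n * τ))
      (v := fun n => grad (U (n + 1)) + grad (U n)) (m := m) (B := 2 * (c * M)) (D := D)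
      (by positivity) (fun n => hKD _ (by positivity)) (hvar τ hτ m) fun n hn => by
        have h1 := norm_add_le (grad (U (n + 1))) (grad (U n))
        have h2 := hgrad (n + 1) (by omega)
        have h3 := hgrad n (by omega)
        linarith
    rw [e]
    refine (le_abs_self _).trans ?_
    rw [abs_mul]
    refine (mul_le_of_le_one_left (abs_nonneg _) hε).trans ((abs_real_inner_le_norm _ _).trans ?_)
    refine (mul_le_mul_of_nonneg_left hsum (norm_nonneg _)).trans_eq ?_
    ring
  have hE := sq_normA_le hβ hG hμ₁ hμ₂ hτ hS
  simp only [sub_eq_add_neg, mul_add, Finset.sum_add_distrib] at hE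
  have hF : 0 ≤ τ * ∑ i ∈ Finset.range (m + 1), ‖f (i * τ)‖ := by positivity
  set F := τ * ∑ i ∈ Finset.range (m + 1), ‖f (i * τ)‖
  -- These are the surplus terms created by using one constant for all three data norms.
  have hrest : 0 ≤ M * (2 * ‖grad (U 0)‖ + 2 * ‖grad u1h‖ + 6 * D * c * ‖grad u1h‖
      + 6 * D * c * F + 2 * Cκ * c * ‖grad (U 0)‖ + 2 * Cκ * c * F) := by positivity
  linarith

end Scheme

end HyperbolicMemory

end

/-! ### The stability and solvability theorem -/

theorem theorem4p1 (α σ γ : ℝ) (hβ : HyperbolicMemory.Admissible α σ γ) :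
    ∃ C : ℝ, 0 < C ∧
      ∀ (d : ℕ) (Ω : Set (EuclideanSpace ℝ (Fin d))), IsOpen Ω → Bornology.IsBounded Ω →
      ∀ (Sh : Submodule ℝ (HyperbolicMemory.H10 Ω)), FiniteDimensional ℝ Sh →
      ∀ (G : ℝ → ℝ), HyperbolicMemory.AssumptionA1 G → HyperbolicMemory.AssumptionA2 G →
      ∀ (μ₁ μ₂ : ℝ), 0 ≤ μ₁ → 0 ≤ μ₂ → 0 < μ₁ ^ 2 + μ₂ ^ 2 →
      ∀ (ε : ℝ), (ε = 1 ∨ ε = -1) →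
      ∀ (T τ : ℝ), 0 < T → 0 < τ →
      ∀ (f : ℝ → HyperbolicMemory.L2 Ω) (u0h u1h u2h : Sh),
        -- stability
        (∀ U : ℕ → Sh,
          HyperbolicMemory.IsSolution α σ γ G μ₁ μ₂ ε T τ f u0h u1h u2h U →
          ∀ m : ℕ, 1 ≤ m → (m : ℝ) ≤ T / τ →
            HyperbolicMemory.normA α σ γ τ U m ≤
              HyperbolicMemory.normA α σ γ τ U 0
                + C * (‖HyperbolicMemory.grad u0h‖ + ‖HyperbolicMemory.grad u1h‖
                    + τ * ∑ i ∈ Finset.range (m + 1), ‖f (i * τ)‖)) ∧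
        -- existence
        (∃ U : ℕ → Sh,
          HyperbolicMemory.IsSolution α σ γ G μ₁ μ₂ ε T τ f u0h u1h u2h U) ∧
        -- uniqueness at all time levels that the scheme determines
        (∀ U V : ℕ → Sh,
          HyperbolicMemory.IsSolution α σ γ G μ₁ μ₂ ε T τ f u0h u1h u2h U →
          HyperbolicMemory.IsSolution α σ γ G μ₁ μ₂ ε T τ f u0h u1h u2h V →
          ∀ n : ℕ, n ≤ ⌊T / τ⌋₊ + 1 → U n = V n) := by
  obtain ⟨C, hC, hstab⟩ := hβ.exists_sq_normA_le
  refine ⟨C, hC, ?_⟩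
  intro d Ω _ _ Sh hSh G hG _ μ₁ μ₂ hμ₁ hμ₂ _ ε hε T τ hT hτ f u0h u1h u2h
  refine ⟨fun U hU m _ hmT => ?_, hβ.exists_isSolution hG hμ₁ hμ₂ hτ T u0h u1h u2h,
    fun U V hU hV => hβ.isSolution_unique hG hμ₁ hμ₂ hτ hT hU hV⟩
  -- The estimate is applied at the level `j ≤ m` of maximal energy, where the common bound `M` is
  -- the energy itself. For `j = 0` no equation is used.
  obtain ⟨j, hj, hmax⟩ := Finset.exists_max_image (Finset.range (m + 1))
    (HyperbolicMemory.normA α σ γ τ U) ⟨0, by simp⟩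
  rw [Finset.mem_range] at hj
  have hle : ∀ k ≤ m, HyperbolicMemory.normA α σ γ τ U k
      ≤ HyperbolicMemory.normA α σ γ τ U j := fun k hk =>
    hmax k (Finset.mem_range.2 (by omega))
  have hε1 : |ε| ≤ 1 := by rcases hε with rfl | rfl <;> simp
  have hscheme : ∀ n : ℕ, 1 ≤ n → n ≤ j →
      HyperbolicMemory.SchemeAt α σ γ G μ₁ μ₂ ε τ f u1h U n := fun n hn hnj =>
    hU.2.2 n hn (le_trans (by exact_mod_cast hnj.trans (by omega)) hmT)
  have hest := hstab hG hμ₁ hμ₂ hε1 hτ hscheme fun k hk => hle k (by omega)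
  rw [hU.1] at hest
  have hnn : ∀ k, 0 ≤ HyperbolicMemory.normA α σ γ τ U k := fun k => Real.sqrt_nonneg _
  have hsub : ∑ i ∈ Finset.range (j + 1), ‖f (i * τ)‖
      ≤ ∑ i ∈ Finset.range (m + 1), ‖f (i * τ)‖ :=
    Finset.sum_le_sum_of_subset_of_nonneg (Finset.range_mono (by omega))
      fun n _ _ => norm_nonneg _
  have hmono : C * (‖HyperbolicMemory.grad u0h‖ + ‖HyperbolicMemory.grad u1h‖
        + τ * ∑ i ∈ Finset.range (j + 1), ‖f (i * τ)‖)
      ≤ C * (‖HyperbolicMemory.grad u0h‖ + ‖HyperbolicMemory.grad u1h‖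
        + τ * ∑ i ∈ Finset.range (m + 1), ‖f (i * τ)‖) := by gcongr
  refine (hle m le_rfl).trans (le_trans ?_ (add_le_add_right hmono _))
  set N := HyperbolicMemory.normA α σ γ τ U j
  set N₀ := HyperbolicMemory.normA α σ γ τ U 0
  set X := C * (‖HyperbolicMemory.grad u0h‖ + ‖HyperbolicMemory.grad u1h‖
        + τ * ∑ i ∈ Finset.range (j + 1), ‖f (i * τ)‖)
  have hX : 0 ≤ X := by positivity
  have h0 : N₀ ≤ N := hle 0 (Nat.zero_le _)
  have hN₀ : 0 ≤ N₀ := hnn 0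
  -- If `N > N₀ + X`, then `N > 0` and `N² ≤ N₀² + N X ≤ N (N₀ + X) < N²`.
  by_contra! hlt
  nlinarith [mul_le_mul_of_nonneg_left h0 hN₀]
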